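/- Let $\Lambda$ be a finite tree (the cell) with a distinguished vertex $\overline 0$ (the root) and boundary points $x_1,\dots,x_m\in\mathcal V_\Lambda$ (repetitions are allowed). Let $\Gamma$ be the rooted quasi-Cayley tree generated by $\Lambda$: its vertices are the pairs $(w,x)$ with $w$ a finite word over $\{1,\dots,m\}$ and $x\in\mathcal V_\Lambda$; each copy $\{w\}\times\Lambda$ carries the edges of $\Lambda$, and for every $w$ and $k$ an edge joins the boundary point $(w,x_k)$ to the root $(kw,\overline 0)$ of the copy indexed by $kw$. The root of $\Gamma$ is $(\emptyset,\overline 0)$. The AKLT model on $\Gamma$ has a spin $\deg(x)/2$ at each vertex $x$, and for a finite set $R$ of vertices the Hamiltonian $H_R=\sum_{\{x,y\}\subset R,\ x\sim y}P_{x,y}$, where $P_{x,y}$ is the orthogonal projection onto the subspace of maximal total spin $(\deg x+\deg y)/2$ of the pair $x,y$. Let $\Gamma_n$ be the ball of radius $n$ in the graph distance around the root of $\Gamma$. An infinite-volume ground state is a limit $\omega(A)=\lim_{n\to\infty}\operatorname{Tr}(\rho_nA)$ (existing for every local observable $A$), where each $\rho_n$ is a density matrix supported on $\ker H_{\Gamma_n}$;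 the ground state is unique if there is at most one such $\omega$. Let $\Lambda'$ be the augmentation of $\Lambda$, obtained by attaching to each $x_k$ a new vertex $v_k$ by a new edge, let $\mathcal G_1$ be the set of paths in $\Lambda'$ from $\overline 0$ to one of the $v_k$, and let $|\gamma|$ be the number of edges of $\gamma\in\mathcal G_1$ (equivalently, the number of vertices of $\Lambda$ on $\gamma$). If $$\sum_{\gamma\in\mathcal G_1}\left(\frac13\right)^{|\gamma|}>1,$$ then the AKLT model on $\Gamma$ does not have a unique ground state. -/

import Mathlib

/-! ### The AKLT model on a locally finite graph -/

namespace AKLT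

noncomputable section

open Filter Topology
open scoped Classical ComplexOrder

/-! #### Spin matrices

The spin-`d/2` representation of `su(2)` on `ℂ^{d+1}`; the basis vector with index `k : Fin (d+1)`
is the `S^z`-eigenvector with `k` "ups" among `d` spin-`1/2`s, of eigenvalue `k - d/2`. -/

/-- The spin matrix `S^z`. -/
def spinZ (d : ℕ) : Matrix (Fin (d + 1)) (Fin (d + 1)) ℂ :=
  Matrix.diagonal fun k => (k : ℂ) - (d : ℂ) / 2

/-- The raising operator `S^+ = S^x + i S^y`, `S^+ e_k = √((k+1)(d-k)) e_{k+1}`. -/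
def spinPlus (d : ℕ) : Matrix (Fin (d + 1)) (Fin (d + 1)) ℂ :=
  fun i j => if (i : ℕ) = (j : ℕ) + 1 then
    ((Real.sqrt (((j : ℝ) + 1) * ((d : ℝ) - (j : ℝ))) : ℝ) : ℂ) else 0

/-- The lowering operator `S^- = (S^+)^*`. -/
def spinMinus (d : ℕ) : Matrix (Fin (d + 1)) (Fin (d + 1)) ℂ :=
  (spinPlus d).conjTranspose

/-- The three spin matrices `S^x, S^y, S^z` of spin `d/2`. -/
def spin (d : ℕ) : Fin 3 → Matrix (Fin (d + 1)) (Fin (d + 1)) ℂ :=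
  ![(1 / 2 : ℂ) • (spinPlus d + spinMinus d),
    (-Complex.I / 2) • (spinPlus d - spinMinus d),
    spinZ d]

variable {W : Type*} (G : SimpleGraph W) [G.LocallyFinite]

/-- Basis configurations of a finite region `R`: the spin at `x` is `deg(x)/2`, where the degree is
taken in the whole graph. The Hilbert space `⨂_{x ∈ R} ℂ^{deg(x)+1}` of the region is
`EuclideanSpace ℂ (Config G R)`. -/
abbrev Config (R : Finset W) : Type _ := ∀ x : R, Fin (G.degree (x : W) + 1)

/-- The algebra of observables of the finite region `R`. -/
abbrev Obs (R : Finset W) : Type _ := Matrix (Config G R) (Config G R) ℂ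

variable {G}

/-- A one-site matrix acting at the site `x` of `R` and as the identity elsewhere. -/
def siteObs {R : Finset W} (x : R)
    (M : Matrix (Fin (G.degree (x : W) + 1)) (Fin (G.degree (x : W) + 1)) ℂ) : Obs G R :=
  fun σ τ => if ∀ z, z ≠ x → σ z = τ z then M (σ x) (τ x) else 0

/-- The embedding `A ↦ A ⊗ 1` of the observables of `R` into those of a larger region `S`. -/
def extendObs {R S : Finset W} (h : R ⊆ S) (A : Obs G R) : Obs G S :=
  fun σ τ => if ∀ z : S, (z : W) ∉ R → σ z = τ z
    then A (fun x => σ ⟨x, h x.2⟩) (fun x => τ ⟨x, h x.2⟩) else 0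

variable (G)

/-- The square `∑_α (S^α_x + S^α_y)²` of the total spin of the sites `x` and `y`. -/
def pairCasimir (R : Finset W) (x y : R) : Obs G R :=
  ∑ α : Fin 3, (siteObs x (spin (G.degree (x : W)) α) + siteObs y (spin (G.degree (y : W)) α)) ^ 2

/-- The largest total spin `J = (deg x + deg y)/2` of the pair `x, y`. -/
def maxSpin {R : Finset W} (x y : R) : ℂ :=
  ((G.degree (x : W) : ℂ) + (G.degree (y : W) : ℂ)) / 2

/-- The AKLT interaction of `x` and `y`: the orthogonal projection onto the subspace of total spin
`J = (deg x + deg y)/2`, i.e. onto the eigenspace of the squared total spin for `J(J+1)`. -/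
def pairProjection (R : Finset W) (x y : R) : Obs G R :=
  (Matrix.toEuclideanCLM (n := Config G R) (𝕜 := ℂ)).symm
    (Module.End.eigenspace
      (Matrix.toEuclideanCLM (n := Config G R) (𝕜 := ℂ) (pairCasimir G R x y)).toLinearMap
      (maxSpin G x y * (maxSpin G x y + 1))).starProjection

theorem pairProjection_symm (R : Finset W) (x y : R) :
    pairProjection G R x y = pairProjection G R y x := by
  have h₁ : pairCasimir G R x y = pairCasimir G R y x := by
    simp only [pairCasimir, add_comm]
  have h₂ : maxSpin G x y = maxSpin G y x := by
    simp only [maxSpin, add_comm]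
  simp only [pairProjection, h₁, h₂]

/-- The AKLT Hamiltonian of the finite region `R`: the sum of the interactions over all edges of
the graph with both ends in `R`. -/
def hamiltonian (R : Finset W) : Obs G R :=
  ∑ e ∈ (G.comap (Subtype.val : R → W)).edgeFinset,
    Sym2.lift ⟨pairProjection G R, pairProjection_symm G R⟩ e

/-- The finite-volume ground states of `R` (for all boundary conditions), as density matrices: those
supported on the kernel of the Hamiltonian. -/
structure IsGroundState (R : Finset W) (ρ : Obs G R) : Prop where
  posSemidef : ρ.PosSemidef
  trace_eq_one : ρ.trace = 1
  hamiltonian_mul : hamiltonian G R * ρ = 0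

/-- The vertices at graph distance at most `n` from `o`. -/
def ball (o : W) : ℕ → Finset W
  | 0 => {o}
  | n + 1 => ball o n ∪ (ball o n).biUnion fun x => G.neighborFinset x

/-- The expectation `Tr(ρ (A ⊗ 1))` in a state `ρ` of the region `S` of an observable `A` of a
region `R ⊆ S` (and `0` if `R` is not contained in `S`). -/
def expectation {S : Finset W} (ρ : Obs G S) {R : Finset W} (A : Obs G R) : ℂ :=
  if h : R ⊆ S then (ρ * extendObs h A).trace else 0

/-- `ω`, given by its values on the local observables (which determine a state of the quasi-local
algebra), is an infinite-volume ground state: for some sequence of ground states on the balls around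
`o`, one has `ω(A) = lim_n ω_n(A)` for every local observable `A`. -/
def IsInfiniteVolumeGroundState (o : W) (ω : ∀ R : Finset W, Obs G R → ℂ) : Prop :=
  ∃ ρ : ∀ n : ℕ, Obs G (ball G o n),
    (∀ n, IsGroundState G (ball G o n) (ρ n)) ∧
    ∀ (R : Finset W) (A : Obs G R),
      Tendsto (fun n => expectation G (ρ n) A) atTop (𝓝 (ω R A))

/-- The infinite-volume ground state does not depend on the choice of the finite-volume ground
states of which it is the limit. -/
def HasUniqueGroundState (o : W) : Prop :=
  ∀ ω₁ ω₂ : ∀ R : Finset W, Obs G R → ℂ,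
    IsInfiniteVolumeGroundState G o ω₁ → IsInfiniteVolumeGroundState G o ω₂ → ω₁ = ω₂

end

end AKLT

/-! ### Quasi-Cayley trees -/

namespace QuasiCayley

variable {V ι : Type*}

/-- The tree-like graph generated by the cell `Λ` with root `r` and boundary points `b k`, `k : ι`.
The copies of the cell are indexed by the words in `ι`, the nodes of the rooted tree in which every
node has one child for each boundary point; an edge joins the boundary point `b k` of the copy `w`
to the root of the copy `k :: w`. If `b` is injective, the boundary is a subset of the cell; for
constant `b` on a one-point cell the graph is the rooted Cayley tree. -/
def graph (Λ : SimpleGraph V) (r : V) (b : ι → V) : SimpleGraph (List ι × V) where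
  Adj p q :=
    (p.1 = q.1 ∧ Λ.Adj p.2 q.2) ∨
    (∃ k, q.1 = k :: p.1 ∧ p.2 = b k ∧ q.2 = r) ∨
    (∃ k, p.1 = k :: q.1 ∧ q.2 = b k ∧ p.2 = r)
  symm := ⟨by
    rintro p q (⟨h, h'⟩ | h | h)
    · exact Or.inl ⟨h.symm, h'.symm⟩
    · exact Or.inr (Or.inr h)
    · exact Or.inr (Or.inl h)⟩
  loopless := ⟨by
    rintro p (⟨-, h⟩ | ⟨k, h, -⟩ | ⟨k, h, -⟩)
    · exact Λ.loopless.irrefl _ h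
    · exact absurd (congrArg List.length h) (by simp)
    · exact absurd (congrArg List.length h) (by simp)⟩

theorem finite_neighborSet [Finite V] [Finite ι] (Λ : SimpleGraph V) (r : V) (b : ι → V)
    (p : List ι × V) : ((graph Λ r b).neighborSet p).Finite := by
  have h : (graph Λ r b).neighborSet p ⊆
      (({p.1} : Set (List ι)) ∪ Set.range (fun k => k :: p.1) ∪ {p.1.tail}) ×ˢ Set.univ := by
    rintro q (⟨h, -⟩ | ⟨k, h, -⟩ | ⟨k, h, -⟩)
    · exact ⟨Or.inl (Or.inl h.symm), trivial⟩
    · exact ⟨Or.inl (Or.inr ⟨k, h.symm⟩), trivial⟩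
    · exact ⟨Or.inr (by simp [h]), trivial⟩
  exact Set.Finite.subset
    ((((Set.finite_singleton _).union (Set.finite_range _)).union
      (Set.finite_singleton _)).prod Set.finite_univ) h

noncomputable instance [Finite V] [Finite ι] (Λ : SimpleGraph V) (r : V) (b : ι → V) :
    (graph Λ r b).LocallyFinite :=
  fun p => (finite_neighborSet Λ r b p).fintype

/-- The augmentation of the cell: a new vertex `v_k = inr k` is attached to each boundary point
`b k` by a new edge. -/
def augmentation (Λ : SimpleGraph V) (b : ι → V) : SimpleGraph (V ⊕ ι) where
  Adj
    | .inl x, .inl y => Λ.Adj x y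
    | .inl x, .inr k => x = b k
    | .inr k, .inl x => x = b k
    | .inr _, .inr _ => False
  symm := ⟨by
    rintro (x | k) (y | l) h
    · exact Λ.symm.symm _ _ h
    · exact h
    · exact h
    · exact h⟩
  loopless := ⟨by
    rintro (x | k) h
    · exact Λ.loopless.irrefl _ h
    · exact h⟩

/-- The sum of `(1/3)^{|γ|}` over all paths `γ` in the augmentation from the root of the cell to one
of the new vertices `v_k`. Here `|γ|` is the number of edges of `γ`; it is the number of vertices of
the cell itself on `γ`. -/
noncomputable def pathSum [Fintype ι] (Λ : SimpleGraph V) (r : V) (b : ι → V) : ℝ :=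
  ∑ k : ι, ∑ᶠ γ : (augmentation Λ b).Path (Sum.inl r) (Sum.inr k),
    (1 / 3 : ℝ) ^ (γ : (augmentation Λ b).Walk (Sum.inl r) (Sum.inr k)).length

end QuasiCayley

/-! Two different ground states are constructed, with opposite staggered magnetisations. In the
Schwinger boson picture spin $d/2$ is the space of homogeneous polynomials of degree $d$ in $u,v$,
and the squared total spin of a pair is $J(J+1)-T^*T$, where $T$ contracts the pair with a singlet
(`pairCasimir_eq`). Polynomials divisible by $u_xv_y-v_xu_y$ lie in the range of $T^*$, so the
interaction annihilates them (`pairProjection_mulVec_polyAmplitude`). With $v=1$, a valence bond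
state of a region is a product of factors $X_p-X_c$ over its inner edges, times a choice of up or
down on each edge (leg) leaving the region.

Mix these states over independent random leg spins. Tracing out an outermost vertex $c$ gives a
mixture of the same kind: distinct powers of $X_c$ are orthogonal, so the two orientations of the
bond above $c$ do not interfere, and the leg above $c$ is up with a probability computed from the
legs below (`sum_bondMixture_glueConfig`). Leg probabilities $q$ that are consistent under this map
define an infinite-volume ground state (`exists_infiniteVolumeGroundState`). For the magnetisation
$m=2q-1$ the map is $m_c=-\rho(m|_{\text{children}})$, with $\rho$ the function `legResponse`. The
sign is absorbed by writing $m=\pm(-1)^{\mathrm{depth}}\mu$, and $\rho$ is odd, so every solution of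
$\mu_x=\rho(\mu|_{\text{children}})$ yields two states; $S^z$ at the root separates them if
$\mu_o\ne0$ (`not_hasUniqueGroundState`).

To find such a $\mu$ on the quasi-Cayley tree, let it depend only on the position in the cell. If
the roots of the next copies carry $t$, solving the recursion in one cell gives a value $F(t)$ at
its root, and a solution is a fixed point of $F$. Here $F$ is continuous, maps $[-1,1]$ to itself,
and $F(0)=0$. At $\mu=0$ every vertex, whatever its degree, transmits exactly one third of the sum
of its legs (`hasDerivAt_legResponse`); hence $F'(0)$ is the path sum
(`eq_sum_of_cellLinearStep_eq`). Slope larger than $1$ forces a positive fixed point. -/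

namespace AKLT
open Filter Topology
open scoped Classical ComplexOrder

noncomputable section

/-! ### Boson operators and spin matrices -/

/-- The annihilation operator `∂/∂u` on homogeneous polynomials of degree `d` in `u, v`,
in the basis of normalised monomials, the target being indexed by the power of `u`. -/
def annihilateUp (d : ℕ) : Matrix (Fin (d + 1)) (Fin (d + 1)) ℂ :=
  fun i j => if (j : ℕ) = (i : ℕ) + 1 then ((Real.sqrt (j : ℝ) : ℝ) : ℂ) else 0

/-- The annihilation operator `∂/∂v`. -/
def annihilateDown (d : ℕ) : Matrix (Fin (d + 1)) (Fin (d + 1)) ℂ :=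
  Matrix.diagonal fun k => ((Real.sqrt ((d : ℝ) - (k : ℝ)) : ℝ) : ℂ)

theorem sum_fin_ite_pred {d : ℕ} (i : Fin (d + 1)) (f : Fin (d + 1) → ℂ) :
    ∑ j : Fin (d + 1), (if (i : ℕ) = (j : ℕ) + 1 then f j else 0) =
      if h : 0 < (i : ℕ) then f ⟨i - 1, by omega⟩ else 0 := by
  split_ifs with h
  · rw [Finset.sum_eq_single ⟨(i : ℕ) - 1, by omega⟩]
    · rw [if_pos]; simp; omega
    · intro j _ hj
      rw [if_neg]
      intro h'
      apply hj
      ext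
      simp; omega
    · simp
  · apply Finset.sum_eq_zero
    intro j _
    rw [if_neg]; omega

theorem sum_fin_ite_succ {d : ℕ} (i : Fin (d + 1)) (f : Fin (d + 1) → ℂ) :
    ∑ j : Fin (d + 1), (if (j : ℕ) = (i : ℕ) + 1 then f j else 0) =
      if h : (i : ℕ) < d then f ⟨i + 1, by omega⟩ else 0 := by
  split_ifs with h
  · rw [Finset.sum_eq_single ⟨(i : ℕ) + 1, by omega⟩]
    · simp
    · intro j _ hj
      rw [if_neg]
      intro h'
      apply hj
      ext
      simp; omega
    · simp
  · apply Finset.sum_eq_zero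
    intro j _
    rw [if_neg]; omega

theorem ofReal_sqrt_mul_self {x : ℝ} (hx : 0 ≤ x) :
    ((Real.sqrt x : ℝ) : ℂ) * ((Real.sqrt x : ℝ) : ℂ) = (x : ℂ) := by
  rw [← Complex.ofReal_mul, Real.mul_self_sqrt hx]

theorem annihilateUp_conjTranspose_mul_self (d : ℕ) :
    (annihilateUp d).conjTranspose * annihilateUp d = Matrix.diagonal fun k : Fin (d + 1) => (k : ℂ) := by
  ext i j
  simp only [Matrix.mul_apply, Matrix.conjTranspose_apply, annihilateUp, Matrix.diagonal_apply,
    apply_ite (star : ℂ → ℂ), star_zero, ite_mul, zero_mul]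
  rw [sum_fin_ite_pred i (fun k => star ((Real.sqrt (i : ℝ) : ℝ) : ℂ) *
    (if (j : ℕ) = (k : ℕ) + 1 then ((Real.sqrt (j : ℝ) : ℝ) : ℂ) else 0))]
  by_cases hij : i = j
  · subst hij
    by_cases h : 0 < (i : ℕ)
    · have : (i : ℕ) = i - 1 + 1 := by omega
      simp only [h, dif_pos, if_pos this, if_true]
      simp only [RCLike.star_def, Complex.conj_ofReal]
      rw [ofReal_sqrt_mul_self (by positivity)]; simp
    · have : (i : ℕ) = 0 := by omega
      simp [this]
  · rw [if_neg hij]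
    have : (i : ℕ) ≠ j := fun h => hij (Fin.ext h)
    split_ifs with h h'
    · simp at h'; omega
    · simp
    · rfl

theorem annihilateDown_conjTranspose (d : ℕ) :
    (annihilateDown d).conjTranspose = annihilateDown d := by
  simp only [annihilateDown, Matrix.diagonal_conjTranspose]
  congr 1
  ext k
  simp

theorem annihilateDown_conjTranspose_mul_self (d : ℕ) :
    (annihilateDown d).conjTranspose * annihilateDown d =
      Matrix.diagonal fun k : Fin (d + 1) => (d : ℂ) - (k : ℂ) := by
  rw [annihilateDown_conjTranspose]
  simp only [annihilateDown, Matrix.diagonal_mul_diagonal]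
  congr 1
  ext k
  have : (k : ℝ) ≤ d := by exact_mod_cast Nat.lt_succ_iff.mp k.2
  rw [ofReal_sqrt_mul_self (by linarith)]
  simp

theorem annihilateUp_conjTranspose_mul_annihilateDown (d : ℕ) :
    (annihilateUp d).conjTranspose * annihilateDown d = spinPlus d := by
  ext i j
  rw [annihilateDown, Matrix.mul_diagonal]
  simp only [Matrix.conjTranspose_apply, annihilateUp, spinPlus]
  split_ifs with h
  · simp only [RCLike.star_def, Complex.conj_ofReal]
    rw [← Complex.ofReal_mul, ← Real.sqrt_mul (by positivity), h]
    push_cast; rfl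
  · simp

theorem annihilateDown_conjTranspose_mul_annihilateUp (d : ℕ) :
    (annihilateDown d).conjTranspose * annihilateUp d = spinMinus d := by
  rw [spinMinus, ← annihilateUp_conjTranspose_mul_annihilateDown, Matrix.conjTranspose_mul,
    Matrix.conjTranspose_conjTranspose]

theorem spinPlus_mul_spinMinus (d : ℕ) :
    spinPlus d * spinMinus d = Matrix.diagonal fun k : Fin (d + 1) => (k : ℂ) * ((d : ℂ) - k + 1) := by
  ext i j
  simp only [Matrix.mul_apply, spinMinus, Matrix.conjTranspose_apply, spinPlus,
    Matrix.diagonal_apply, apply_ite (star : ℂ → ℂ), star_zero, ite_mul, zero_mul]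
  rw [sum_fin_ite_pred i]
  by_cases hij : i = j
  · subst hij
    by_cases h : 0 < (i : ℕ)
    · have h1 : (i : ℕ) = i - 1 + 1 := by omega
      have h2 : (i : ℝ) ≤ d := by exact_mod_cast Nat.lt_succ_iff.mp i.2
      simp only [h, dif_pos, if_pos h1, if_true]
      simp only [RCLike.star_def, Complex.conj_ofReal]
      have h3 : (((i : ℕ) - 1 : ℕ) : ℝ) = (i : ℝ) - 1 := by rw [Nat.cast_sub h]; simp
      rw [h3, ofReal_sqrt_mul_self (mul_nonneg (by simp) (by linarith))]
      push_cast; ring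
    · have : (i : ℕ) = 0 := by omega
      simp [this]
  · rw [if_neg hij]
    have : (i : ℕ) ≠ j := fun h => hij (Fin.ext h)
    split_ifs with h h'
    · simp at h'; omega
    · simp
    · rfl

theorem spinMinus_mul_spinPlus (d : ℕ) :
    spinMinus d * spinPlus d = Matrix.diagonal fun k : Fin (d + 1) => ((k : ℂ) + 1) * ((d : ℂ) - k) := by
  ext i j
  simp only [Matrix.mul_apply, spinMinus, Matrix.conjTranspose_apply, spinPlus,
    Matrix.diagonal_apply, apply_ite (star : ℂ → ℂ), star_zero, ite_mul, zero_mul]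
  rw [sum_fin_ite_succ i]
  by_cases hij : i = j
  · subst hij
    have h2 : (i : ℝ) ≤ d := by exact_mod_cast Nat.lt_succ_iff.mp i.2
    by_cases h : (i : ℕ) < d
    · simp only [h, dif_pos, if_true]
      simp only [RCLike.star_def, Complex.conj_ofReal]
      rw [ofReal_sqrt_mul_self (mul_nonneg (by positivity) (by linarith))]
      push_cast; ring
    · have : (i : ℕ) = d := by omega
      simp [this]
  · rw [if_neg hij]
    have : (i : ℕ) ≠ j := fun h => hij (Fin.ext h)
    split_ifs with h h'
    · simp at h'; omega
    · simp
    · rfl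

/-! ### One-site observables -/

variable {W : Type*} {G : SimpleGraph W} [G.LocallyFinite] {R : Finset W}

theorem forall_ne_eq_iff (σ τ : Config G R) (x : R) :
    (∀ z, z ≠ x → σ z = τ z) ↔ τ = Function.update σ x (τ x) := by
  constructor
  · intro h
    ext1 z
    by_cases hz : z = x
    · subst hz; simp
    · rw [Function.update_of_ne hz, h z hz]
  · intro h z hz
    rw [h, Function.update_of_ne hz]

theorem sum_siteObs_mul (x : R)
    (M : Matrix (Fin (G.degree (x : W) + 1)) (Fin (G.degree (x : W) + 1)) ℂ)
    (σ : Config G R) (f : Config G R → ℂ) :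
    ∑ τ, siteObs x M σ τ * f τ = ∑ j, M (σ x) j * f (Function.update σ x j) := by
  simp only [siteObs, ite_mul, zero_mul]
  rw [← Finset.sum_filter]
  refine Finset.sum_bij' (fun τ _ => τ x) (fun j _ => Function.update σ x j) ?_ ?_ ?_ ?_ ?_
  · simp
  · intro j _
    simp only [Finset.mem_filter, Finset.mem_univ, true_and]
    intro z hz
    rw [Function.update_of_ne hz]
  · intro τ hτ
    simp only [Finset.mem_filter, Finset.mem_univ, true_and] at hτ
    exact ((forall_ne_eq_iff σ τ x).1 hτ).symm
  · simp
  · intro τ hτ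
    simp only [Finset.mem_filter, Finset.mem_univ, true_and] at hτ
    rw [← (forall_ne_eq_iff σ τ x).1 hτ]

theorem siteObs_mulVec (x : R)
    (M : Matrix (Fin (G.degree (x : W) + 1)) (Fin (G.degree (x : W) + 1)) ℂ)
    (f : Config G R → ℂ) (σ : Config G R) :
    (siteObs x M).mulVec f σ = ∑ j, M (σ x) j * f (Function.update σ x j) :=
  sum_siteObs_mul x M σ f

theorem siteObs_mul (x : R)
    (M N : Matrix (Fin (G.degree (x : W) + 1)) (Fin (G.degree (x : W) + 1)) ℂ) :
    (siteObs x (M * N) : Obs G R) = siteObs x M * siteObs x N := by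
  ext σ τ
  rw [Matrix.mul_apply, sum_siteObs_mul]
  have h : ∀ j, (∀ z, z ≠ x → Function.update σ x j z = τ z) ↔ ∀ z, z ≠ x → σ z = τ z := by
    intro j
    refine forall₂_congr fun z hz => ?_
    rw [Function.update_of_ne hz]
  simp only [siteObs, h, Function.update_self]
  split_ifs
  · rw [Matrix.mul_apply]
  · simp

theorem siteObs_mul_siteObs_apply {x y : R} (hxy : x ≠ y)
    (M : Matrix (Fin (G.degree (x : W) + 1)) (Fin (G.degree (x : W) + 1)) ℂ)
    (N : Matrix (Fin (G.degree (y : W) + 1)) (Fin (G.degree (y : W) + 1)) ℂ)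
    (σ τ : Config G R) :
    (siteObs x M * siteObs y N : Obs G R) σ τ =
      if ∀ z, z ≠ x → z ≠ y → σ z = τ z then M (σ x) (τ x) * N (σ y) (τ y) else 0 := by
  rw [Matrix.mul_apply, sum_siteObs_mul]
  rw [Finset.sum_eq_single (τ x)]
  · simp only [siteObs]
    rw [Function.update_of_ne hxy.symm]
    have : (∀ z, z ≠ y → Function.update σ x (τ x) z = τ z) ↔
        ∀ z, z ≠ x → z ≠ y → σ z = τ z := by
      constructor
      · intro h z hx hy
        rw [← h z hy, Function.update_of_ne hx]
      · intro h z hy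
        by_cases hx : z = x
        · subst hx; simp
        · rw [Function.update_of_ne hx, h z hx hy]
    simp only [this, mul_ite, mul_zero]
  · intro j _ hj
    rw [siteObs, if_neg, mul_zero]
    intro h
    apply hj
    rw [← h x hxy, Function.update_self]
  · simp

theorem siteObs_commute {x y : R} (hxy : x ≠ y)
    (M : Matrix (Fin (G.degree (x : W) + 1)) (Fin (G.degree (x : W) + 1)) ℂ)
    (N : Matrix (Fin (G.degree (y : W) + 1)) (Fin (G.degree (y : W) + 1)) ℂ) :
    (siteObs x M * siteObs y N : Obs G R) = siteObs y N * siteObs x M := by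
  ext σ τ
  rw [siteObs_mul_siteObs_apply hxy, siteObs_mul_siteObs_apply hxy.symm]
  simp only [mul_comm]
  congr 1
  simp only [eq_iff_iff]
  exact forall_congr' fun z => ⟨fun h a b => h b a, fun h a b => h b a⟩

theorem siteObs_conjTranspose (x : R)
    (M : Matrix (Fin (G.degree (x : W) + 1)) (Fin (G.degree (x : W) + 1)) ℂ) :
    (siteObs x M : Obs G R).conjTranspose = siteObs x M.conjTranspose := by
  ext σ τ
  simp only [siteObs, Matrix.conjTranspose_apply, eq_comm]
  split_ifs <;> simp

theorem siteObs_add (x : R)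
    (M N : Matrix (Fin (G.degree (x : W) + 1)) (Fin (G.degree (x : W) + 1)) ℂ) :
    (siteObs x (M + N) : Obs G R) = siteObs x M + siteObs x N := by
  ext σ τ
  simp only [siteObs, Matrix.add_apply]
  split_ifs <;> simp

theorem siteObs_smul (x : R) (c : ℂ)
    (M : Matrix (Fin (G.degree (x : W) + 1)) (Fin (G.degree (x : W) + 1)) ℂ) :
    (siteObs x (c • M) : Obs G R) = c • siteObs x M := by
  ext σ τ
  simp only [siteObs, Matrix.smul_apply]
  split_ifs <;> simp

theorem siteObs_sub (x : R)
    (M N : Matrix (Fin (G.degree (x : W) + 1)) (Fin (G.degree (x : W) + 1)) ℂ) :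
    (siteObs x (M - N) : Obs G R) = siteObs x M - siteObs x N := by
  ext σ τ
  simp only [siteObs, Matrix.sub_apply]
  split_ifs <;> simp

theorem siteObs_one (x : R) : (siteObs x 1 : Obs G R) = 1 := by
  ext σ τ
  simp only [siteObs, Matrix.one_apply]
  by_cases h : σ = τ
  · subst h; simp
  · rw [if_neg h]
    split_ifs with h₁ h₂
    · exact absurd (funext fun z => if hz : z = x then hz ▸ h₂ else h₁ z hz) h
    · rfl
    · rfl

/-! ### The AKLT interaction -/

/-- The contraction of the pair `x, y` with a singlet, with values in spins lowered by one half. -/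
def singletContraction (x y : R) : Obs G R :=
  siteObs x (annihilateUp _) * siteObs y (annihilateDown _) -
    siteObs x (annihilateDown _) * siteObs y (annihilateUp _)

/-- The one-site identity $S^2=s(s+1)$ with $s=d/2$; it evaluates the diagonal terms of the pair
Casimir. -/
theorem spin_casimir (d : ℕ) :
    (1 / 2 : ℂ) • (spinPlus d * spinMinus d + spinMinus d * spinPlus d) + spinZ d * spinZ d =
      ((d : ℂ) / 2 * ((d : ℂ) / 2 + 1)) • (1 : Matrix _ _ ℂ) := by
  rw [spinPlus_mul_spinMinus, spinMinus_mul_spinPlus, spinZ, Matrix.diagonal_mul_diagonal,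
    Matrix.diagonal_add, ← Matrix.diagonal_smul, Matrix.diagonal_add, Matrix.smul_one_eq_diagonal]
  congr 1
  ext k
  simp only [Pi.smul_apply, smul_eq_mul]
  ring

theorem number_eq_spinZ_add (d : ℕ) :
    (Matrix.diagonal fun k : Fin (d + 1) => (k : ℂ)) =
      spinZ d + ((d : ℂ) / 2) • (1 : Matrix _ _ ℂ) := by
  rw [spinZ, Matrix.smul_one_eq_diagonal, Matrix.diagonal_add]
  congr 1; ext k; ring

theorem number_eq_sub_spinZ (d : ℕ) :
    (Matrix.diagonal fun k : Fin (d + 1) => (d : ℂ) - (k : ℂ)) =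
      ((d : ℂ) / 2) • (1 : Matrix _ _ ℂ) - spinZ d := by
  rw [spinZ, Matrix.smul_one_eq_diagonal, Matrix.diagonal_sub]
  congr 1; ext k; ring

/-- For the total spin as for one spin, $(S^x)^2+(S^y)^2=\tfrac12(S^+S^-+S^-S^+)$. The ladder form
matters because $S^\pm$ are products of boson operators. -/
theorem pairCasimir_eq_ladder (x y : R) :
    pairCasimir G R x y =
      (1 / 2 : ℂ) • ((siteObs x (spinPlus _) + siteObs y (spinPlus _)) *
          (siteObs x (spinMinus _) + siteObs y (spinMinus _)) +
        (siteObs x (spinMinus _) + siteObs y (spinMinus _)) *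
          (siteObs x (spinPlus _) + siteObs y (spinPlus _))) +
      (siteObs x (spinZ _) + siteObs y (spinZ _)) ^ 2 := by
  simp only [pairCasimir, Fin.sum_univ_three, spin, Matrix.cons_val_zero, Matrix.cons_val_one,
    Matrix.cons_val, siteObs_smul, siteObs_add, siteObs_sub]
  congr 1
  generalize (siteObs x (spinPlus (G.degree (x : W))) : Obs G R) = a
  generalize (siteObs y (spinPlus (G.degree (y : W))) : Obs G R) = b
  generalize (siteObs x (spinMinus (G.degree (x : W))) : Obs G R) = c
  generalize (siteObs y (spinMinus (G.degree (y : W))) : Obs G R) = d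
  have h1 : (1 / 2 : ℂ) • (a + c) + (1 / 2 : ℂ) • (b + d) = (1 / 2 : ℂ) • ((a + b) + (c + d)) := by
    rw [← smul_add]; congr 1; abel
  have h2 : (-Complex.I / 2) • (a - c) + (-Complex.I / 2) • (b - d) =
      (-Complex.I / 2) • ((a + b) - (c + d)) := by
    rw [← smul_add]; congr 1; abel
  rw [h1, h2, smul_pow, smul_pow]
  have h3 : (-Complex.I / 2) ^ 2 = -(1 / 4 : ℂ) := by
    rw [div_pow, neg_sq, Complex.I_sq]; norm_num
  rw [h3]
  generalize a + b = P
  generalize c + d = Q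
  have h4 : (P + Q) ^ 2 - (P - Q) ^ 2 = (2 : ℂ) • (P * Q + Q * P) := by
    rw [two_smul]; noncomm_ring
  have h5 : ((1 / 2 : ℂ) ^ 2) = 1 / 4 := by norm_num
  rw [h5, neg_smul, ← sub_eq_add_neg, ← smul_sub, h4, smul_smul]
  norm_num

/-- $T^*T$ expands into number operators and the hopping terms $S_x^\pm S_y^\mp$, that is, into
$2s_xs_y-2\,S_x\cdot S_y$. Since $J=s_x+s_y$, adding the two one-site Casimirs gives the formula. It
identifies the eigenspace of maximal spin with $\ker T$. -/
theorem pairCasimir_eq {x y : R} (hxy : x ≠ y) :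
    pairCasimir G R x y = (maxSpin G x y * (maxSpin G x y + 1)) • (1 : Obs G R) -
      (singletContraction x y).conjTranspose * singletContraction x y := by
  have hT : (singletContraction x y : Obs G R).conjTranspose * singletContraction x y =
      (siteObs x (spinZ _) + ((G.degree (x : W) : ℂ) / 2) • 1) *
        (((G.degree (y : W) : ℂ) / 2) • 1 - siteObs y (spinZ _)) +
      (((G.degree (x : W) : ℂ) / 2) • 1 - siteObs x (spinZ _)) *
        (siteObs y (spinZ _) + ((G.degree (y : W) : ℂ) / 2) • 1) -
      siteObs x (spinPlus _) * siteObs y (spinMinus _) -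
      siteObs x (spinMinus _) * siteObs y (spinPlus _) := by
    -- Operators at different sites commute, so each of the four products in $T^*T$ factors into
    -- one-site products.
    have key : ∀ (A B : Matrix (Fin (G.degree (x : W) + 1)) (Fin (G.degree (x : W) + 1)) ℂ)
        (C D : Matrix (Fin (G.degree (y : W) + 1)) (Fin (G.degree (y : W) + 1)) ℂ),
        (siteObs x A * siteObs y C : Obs G R).conjTranspose * (siteObs x B * siteObs y D) =
          siteObs x (A.conjTranspose * B) * siteObs y (C.conjTranspose * D) := by
      intro A B C D
      rw [Matrix.conjTranspose_mul, siteObs_conjTranspose, siteObs_conjTranspose, siteObs_mul,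
        siteObs_mul, siteObs_commute hxy.symm]
      simp only [mul_assoc]
      congr 1
      simp only [← mul_assoc]
      rw [siteObs_commute hxy.symm]
    simp only [singletContraction, Matrix.conjTranspose_sub, sub_mul, mul_sub, key]
    rw [annihilateUp_conjTranspose_mul_self, annihilateUp_conjTranspose_mul_self,
      annihilateDown_conjTranspose_mul_self, annihilateDown_conjTranspose_mul_self,
      annihilateUp_conjTranspose_mul_annihilateDown, annihilateUp_conjTranspose_mul_annihilateDown,
      annihilateDown_conjTranspose_mul_annihilateUp, annihilateDown_conjTranspose_mul_annihilateUp,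
      number_eq_spinZ_add, number_eq_spinZ_add, number_eq_sub_spinZ, number_eq_sub_spinZ]
    simp only [siteObs_add, siteObs_sub, siteObs_smul, siteObs_one, add_mul, sub_mul, mul_add,
      mul_sub]
    abel
  have hx := congrArg (siteObs (G := G) x) (spin_casimir (G.degree (x : W)))
  have hy := congrArg (siteObs (G := G) y) (spin_casimir (G.degree (y : W)))
  simp only [siteObs_add, siteObs_smul, siteObs_one, siteObs_mul] at hx hy
  rw [hT, pairCasimir_eq_ladder]
  have c1 := siteObs_commute hxy (spinPlus (G.degree (x : W))) (spinMinus (G.degree (y : W)))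
  have c2 := siteObs_commute hxy (spinMinus (G.degree (x : W))) (spinPlus (G.degree (y : W)))
  have c3 := siteObs_commute hxy (spinZ (G.degree (x : W))) (spinZ (G.degree (y : W)))
  rw [maxSpin]
  generalize (siteObs x (spinPlus (G.degree (x : W))) : Obs G R) = a at *
  generalize (siteObs y (spinPlus (G.degree (y : W))) : Obs G R) = b at *
  generalize (siteObs x (spinMinus (G.degree (x : W))) : Obs G R) = c at *
  generalize (siteObs y (spinMinus (G.degree (y : W))) : Obs G R) = d at *
  generalize (siteObs x (spinZ (G.degree (x : W))) : Obs G R) = e at *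
  generalize (siteObs y (spinZ (G.degree (y : W))) : Obs G R) = f at *
  generalize (G.degree (x : W) : ℂ) = p at *
  generalize (G.degree (y : W) : ℂ) = q at *
  have e1 : (1 / 2 : ℂ) • ((a + b) * (c + d) + (c + d) * (a + b)) + (e + f) ^ 2 =
      ((1 / 2 : ℂ) • (a * c + c * a) + e * e) + ((1 / 2 : ℂ) • (b * d + d * b) + f * f) +
      (a * d + c * b) + (e * f + e * f) := by
    have : (a + b) * (c + d) + (c + d) * (a + b) =
      (a * c + c * a) + (b * d + d * b) + (2 : ℂ) • (a * d + c * b) := by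
      have h1 : (a + b) * (c + d) + (c + d) * (a + b) = (a * c + c * a) + (b * d + d * b) +
        (a * d + d * a + (c * b + b * c)) := by noncomm_ring
      rw [h1, ← c1, ← c2, two_smul]; abel
    rw [this, smul_add, smul_add, smul_smul]
    have h2 : (e + f) ^ 2 = e * e + f * f + (e * f + f * e) := by noncomm_ring
    rw [h2, ← c3]
    norm_num
    abel
  rw [e1, hx, hy]
  simp only [add_mul, sub_mul, mul_add, mul_sub, smul_mul_assoc, mul_smul_comm, one_mul, mul_one]
  module

/-- An eigenvector $u$ for $J(J+1)$ satisfies $T^*Tu=0$, hence $Tu=0$, hence is orthogonal to the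
range of $T^*$. -/
theorem pairProjection_mulVec_eq_zero {x y : R} (hxy : x ≠ y) (f g : Config G R → ℂ)
    (h : f = (singletContraction x y).conjTranspose.mulVec g) :
    (pairProjection G R x y).mulVec f = 0 := by
  rw [← WithLp.ofLp_toLp 2 f, ← Matrix.ofLp_toEuclideanCLM, pairProjection,
    StarAlgEquiv.apply_symm_apply]
  suffices hf : WithLp.toLp 2 f ∈ (Module.End.eigenspace
      (Matrix.toEuclideanCLM (n := Config G R) (𝕜 := ℂ) (pairCasimir G R x y)).toLinearMap
      (maxSpin G x y * (maxSpin G x y + 1)))ᗮ by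
    rw [(Submodule.starProjection_apply_eq_zero_iff _).2 hf]
    rfl
  rw [Submodule.mem_orthogonal]
  intro u hu
  rw [Module.End.mem_eigenspace_iff] at hu
  have hu' := congrArg WithLp.ofLp hu
  rw [ContinuousLinearMap.coe_coe, Matrix.ofLp_toEuclideanCLM, pairCasimir_eq hxy,
    Matrix.sub_mulVec, Matrix.smul_mulVec, Matrix.one_mulVec, WithLp.ofLp_smul,
    sub_eq_self, Matrix.conjTranspose_mul_self_mulVec_eq_zero] at hu'
  rw [EuclideanSpace.inner_eq_star_dotProduct, h, dotProduct_comm, Matrix.dotProduct_mulVec,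
    Matrix.vecMul_conjTranspose, star_star, hu', star_zero, zero_dotProduct]

/-! ### Polynomial states -/

section PolynomialState

open MvPolynomial

variable {W : Type*} {G : SimpleGraph W} [G.LocallyFinite] {R : Finset W}

/-- The configuration `σ` as an exponent of monomials in variables indexed by the vertices. -/
def configExponent (σ : Config G R) : W →₀ ℕ :=
  Finsupp.onFinset R (fun x => if h : x ∈ R then (σ ⟨x, h⟩ : ℕ) else 0) fun x hx => by
    by_contra h
    simp [h] at hx

theorem configExponent_coe (σ : Config G R) (x : R) : configExponent σ (x : W) = σ x := by
  simp [configExponent]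

theorem configExponent_of_notMem (σ : Config G R) {x : W} (hx : x ∉ R) :
    configExponent σ x = 0 := by
  simp [configExponent, hx]

/-- The squared norm of the monomial with exponent `σ`. -/
def configWeight (σ : Config G R) : ℝ :=
  ∏ x : R, ((Nat.factorial (σ x) * Nat.factorial (G.degree (x : W) - σ x) : ℕ) : ℝ)

theorem configWeight_pos (σ : Config G R) : 0 < configWeight σ := by
  refine Finset.prod_pos fun x _ => ?_
  exact_mod_cast Nat.mul_pos (Nat.factorial_pos _) (Nat.factorial_pos _)

/-- The coordinates of the polynomial `P` in the orthonormal basis of normalised monomials. -/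
def polyAmplitude (R : Finset W) (P : MvPolynomial W ℝ) (σ : Config G R) : ℝ :=
  coeff (configExponent σ) P * Real.sqrt (configWeight σ)

theorem polyAmplitude_sub (P Q : MvPolynomial W ℝ) (σ : Config G R) :
    polyAmplitude R (P - Q) σ = polyAmplitude R P σ - polyAmplitude R Q σ := by
  simp [polyAmplitude, sub_mul]

/-- The configuration `σ` with the entry at `x` lowered by one. -/
def lowerConfig (σ : Config G R) (x : R) : Config G R :=
  Function.update σ x ⟨(σ x : ℕ) - 1, by have := (σ x).2; omega⟩

theorem lowerConfig_self (σ : Config G R) (x : R) : (lowerConfig σ x x : ℕ) = σ x - 1 := by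
  simp [lowerConfig]

theorem lowerConfig_of_ne (σ : Config G R) {x y : R} (h : y ≠ x) : lowerConfig σ x y = σ y := by
  simp [lowerConfig, h]

theorem configExponent_lowerConfig (σ : Config G R) (x : R) :
    configExponent (lowerConfig σ x) = configExponent σ - Finsupp.single (x : W) 1 := by
  ext z
  rw [Finsupp.tsub_apply]
  by_cases hz : z ∈ R
  · by_cases hzx : (⟨z, hz⟩ : R) = x
    · subst hzx
      rw [configExponent_coe _ ⟨z, hz⟩, configExponent_coe _ ⟨z, hz⟩, lowerConfig_self]
      simp
    · rw [configExponent_coe _ ⟨z, hz⟩, configExponent_coe _ ⟨z, hz⟩, lowerConfig_of_ne _ hzx,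
        Finsupp.single_eq_of_ne (fun h => hzx (Subtype.ext h)), tsub_zero]
  · rw [configExponent_of_notMem _ hz, configExponent_of_notMem _ hz, zero_tsub]

/-- This is $k!\,(d-k)!\cdot(d-k+1)=(k-1)!\,(d-k+1)!\cdot k$ at the site $x$. It reconciles
multiplication by $X_x$ with the square roots in the creation operators. -/
theorem configWeight_lowerConfig (σ : Config G R) (x : R) (hx : 0 < (σ x : ℕ)) :
    configWeight σ * ((G.degree (x : W) : ℝ) - (lowerConfig σ x x : ℕ)) =
      configWeight (lowerConfig σ x) * (σ x : ℕ) := by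
  have h1 : ∀ τ : Config G R, configWeight τ =
      ((Nat.factorial (τ x) * Nat.factorial (G.degree (x : W) - τ x) : ℕ) : ℝ) *
      ∏ z ∈ Finset.univ.erase x,
        ((Nat.factorial (τ z) * Nat.factorial (G.degree (z : W) - τ z) : ℕ) : ℝ) :=
    fun τ => (Finset.mul_prod_erase _ _ (Finset.mem_univ x)).symm
  have h2 : ∏ z ∈ Finset.univ.erase x, ((Nat.factorial (lowerConfig σ x z) *
        Nat.factorial (G.degree (z : W) - lowerConfig σ x z) : ℕ) : ℝ) =
      ∏ z ∈ Finset.univ.erase x,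
        ((Nat.factorial (σ z) * Nat.factorial (G.degree (z : W) - σ z) : ℕ) : ℝ) := by
    refine Finset.prod_congr rfl fun z hz => ?_
    rw [lowerConfig_of_ne _ (Finset.ne_of_mem_erase hz)]
  rw [h1 σ, h1 (lowerConfig σ x), h2, lowerConfig_self]
  obtain ⟨k, hk⟩ : ∃ k, (σ x : ℕ) = k + 1 := ⟨σ x - 1, by omega⟩
  obtain ⟨l, hl⟩ : ∃ l, G.degree (x : W) = k + 1 + l :=
    ⟨G.degree (x : W) - (k + 1), by have := (σ x).2; omega⟩
  rw [hk, hl]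
  have e1 : k + 1 + l - (k + 1) = l := by omega
  have e2 : k + 1 + l - (k + 1 - 1) = l + 1 := by omega
  have e3 : k + 1 - 1 = k := by omega
  rw [e1, e2, e3, Nat.factorial_succ, Nat.factorial_succ]
  push_cast
  ring

theorem siteObs_annihilateDown_mulVec (y : R) (f : Config G R → ℂ) (σ : Config G R) :
    (siteObs y (annihilateDown _).conjTranspose).mulVec f σ =
      ((Real.sqrt ((G.degree (y : W) : ℝ) - (σ y : ℕ)) : ℝ) : ℂ) * f σ := by
  rw [siteObs_mulVec, annihilateDown_conjTranspose]
  rw [Finset.sum_eq_single (σ y)]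
  · simp [annihilateDown]
  · intro j _ hj
    simp [annihilateDown, Matrix.diagonal_apply_ne _ hj.symm]
  · simp

theorem siteObs_annihilateUp_mulVec (x : R) (f : Config G R → ℂ) (σ : Config G R) :
    (siteObs x (annihilateUp _).conjTranspose).mulVec f σ =
      ((Real.sqrt (σ x : ℕ) : ℝ) : ℂ) * f (lowerConfig σ x) := by
  rw [siteObs_mulVec]
  simp only [Matrix.conjTranspose_apply, annihilateUp, apply_ite (star : ℂ → ℂ), star_zero,
    ite_mul, zero_mul]
  rw [sum_fin_ite_pred]
  split_ifs with h
  · simp [lowerConfig]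
  · have : (σ x : ℕ) = 0 := by omega
    simp [this]

theorem coeff_eq_zero_of_degreeOf_lt {P : MvPolynomial W ℝ} {m : W →₀ ℕ} {x : W}
    (h : degreeOf x P < m x) : coeff m P = 0 := by
  by_contra hne
  exact absurd (monomial_le_degreeOf x (mem_support_iff.2 hne)) (not_le.2 h)

/-- A preimage of `(X x - X y) * Q` under the adjoint of the singlet contraction. -/
def singletPreimage (Q : MvPolynomial W ℝ) (x y : R) (τ : Config G R) : ℝ :=
  polyAmplitude R Q τ /
    (Real.sqrt ((G.degree (x : W) : ℝ) - (τ x : ℕ)) *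
      Real.sqrt ((G.degree (y : W) : ℝ) - (τ y : ℕ)))

theorem singletPreimage_comm (Q : MvPolynomial W ℝ) (x y : R) (τ : Config G R) :
    singletPreimage Q x y τ = singletPreimage Q y x τ := by
  rw [singletPreimage, singletPreimage, mul_comm (Real.sqrt _)]

/-- With $v=1$, multiplication by $X_x$ stands for multiplication by $u_xv_y$. The square roots are
the matrix entries of the two creation operators, applied to `singletPreimage`. -/
theorem polyAmplitude_X_mul {x y : R} (hxy : x ≠ y) {Q : MvPolynomial W ℝ}
    (hy : degreeOf (y : W) Q < G.degree (y : W)) (σ : Config G R) :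
    polyAmplitude R (X (x : W) * Q) σ =
      Real.sqrt (σ x : ℕ) * (Real.sqrt ((G.degree (y : W) : ℝ) - (σ y : ℕ)) *
        singletPreimage Q x y (lowerConfig σ x)) := by
  rw [polyAmplitude, coeff_X_mul']
  by_cases hx : (σ x : ℕ) = 0
  · rw [if_neg, hx]
    · simp
    · simp [Finsupp.mem_support_iff, configExponent_coe, hx]
  · rw [if_pos (by simpa [Finsupp.mem_support_iff, configExponent_coe] using hx), singletPreimage,
      polyAmplitude, configExponent_lowerConfig, lowerConfig_of_ne _ hxy.symm]
    have hyd : (σ y : ℕ) ≤ G.degree (y : W) := Nat.lt_succ_iff.1 (σ y).2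
    have hxd : (σ x : ℕ) ≤ G.degree (x : W) := Nat.lt_succ_iff.1 (σ x).2
    -- If $\sigma_y$ is maximal, the division in `singletPreimage` is by zero and returns $0$. The
    -- left side vanishes as well, because $Q$ has degree below $\deg y$ in $X_y$.
    rcases hyd.eq_or_lt with he | hlt
    · have : coeff (configExponent σ - Finsupp.single (x : W) 1) Q = 0 := by
        apply coeff_eq_zero_of_degreeOf_lt (x := (y : W))
        rw [← configExponent_lowerConfig, configExponent_coe, lowerConfig_of_ne _ hxy.symm, he]
        exact hy
      simp [this]
    · have h1 : (0 : ℝ) < (G.degree (y : W) : ℝ) - (σ y : ℕ) := by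
        have : ((σ y : ℕ) : ℝ) < G.degree (y : W) := by exact_mod_cast hlt
        linarith
      have h2 : (0 : ℝ) < (G.degree (x : W) : ℝ) - (lowerConfig σ x x : ℕ) := by
        rw [lowerConfig_self]
        have : (((σ x : ℕ) - 1 : ℕ) : ℝ) < G.degree (x : W) := by
          exact_mod_cast (by omega)
        linarith
      have h3 := configWeight_lowerConfig σ x (Nat.pos_of_ne_zero hx)
      have h4 : Real.sqrt (configWeight σ) *
          Real.sqrt ((G.degree (x : W) : ℝ) - (lowerConfig σ x x : ℕ)) =
          Real.sqrt (configWeight (lowerConfig σ x)) * Real.sqrt (σ x : ℕ) := by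
        rw [← Real.sqrt_mul (configWeight_pos _).le, h3, Real.sqrt_mul (configWeight_pos _).le]
      have h5 := (Real.sqrt_pos.2 h1).ne'
      have h6 := (Real.sqrt_pos.2 h2).ne'
      field_simp
      rw [mul_assoc, h4]
      ring

/-- A polynomial state divisible by the singlet of `x` and `y` is annihilated by the interaction. -/
theorem pairProjection_mulVec_polyAmplitude {x y : R} (hxy : x ≠ y) {Q : MvPolynomial W ℝ}
    (hx : degreeOf (x : W) Q < G.degree (x : W)) (hy : degreeOf (y : W) Q < G.degree (y : W)) :
    (pairProjection G R x y).mulVec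
      (fun σ => ((polyAmplitude R ((X (x : W) - X (y : W)) * Q) σ : ℝ) : ℂ)) = 0 := by
  refine pairProjection_mulVec_eq_zero hxy _ (fun σ => ((singletPreimage Q x y σ : ℝ) : ℂ)) ?_
  ext σ
  rw [singletContraction, Matrix.conjTranspose_sub, Matrix.conjTranspose_mul,
    Matrix.conjTranspose_mul]
  simp only [siteObs_conjTranspose]
  rw [siteObs_commute hxy.symm, Matrix.sub_mulVec, ← Matrix.mulVec_mulVec, ← Matrix.mulVec_mulVec,
    Pi.sub_apply, siteObs_annihilateUp_mulVec, siteObs_annihilateUp_mulVec,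
    siteObs_annihilateDown_mulVec, siteObs_annihilateDown_mulVec, sub_mul, polyAmplitude_sub,
    polyAmplitude_X_mul hxy hy, polyAmplitude_X_mul hxy.symm hx, lowerConfig_of_ne _ hxy.symm,
    lowerConfig_of_ne _ hxy, singletPreimage_comm Q y x]
  push_cast
  ring

end PolynomialState

/-! ### Rooted trees -/

section RootedTree

variable {W : Type*}

/-- The graph `G` is a tree with root `o`, parent map `par` and depth function `dep`. -/
structure IsRootedTree (G : SimpleGraph W) (o : W) (par : W → W) (dep : W → ℕ) : Prop where
  dep_root : dep o = 0
  dep_par : ∀ x, x ≠ o → dep x = dep (par x) + 1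
  adj_iff : ∀ x y, G.Adj x y ↔ (x ≠ o ∧ par x = y) ∨ (y ≠ o ∧ par y = x)

theorem IsRootedTree.par_ne_self {G : SimpleGraph W} {o : W} {par : W → W} {dep : W → ℕ}
    (h : IsRootedTree G o par dep) {x : W} (hx : x ≠ o) : par x ≠ x := by
  intro h'
  have := h.dep_par x hx
  rw [h'] at this
  omega

theorem IsRootedTree.eq_root_of_dep_eq_zero {G : SimpleGraph W} {o : W} {par : W → W} {dep : W → ℕ}
    (h : IsRootedTree G o par dep) {x : W} (hx : dep x = 0) :
    x = o := by
  by_contra hne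
  have := h.dep_par x hne
  omega

/-- The children of the vertex `x`. -/
def children (G : SimpleGraph W) [G.LocallyFinite] (o : W) (par : W → W) (x : W) : Finset W :=
  (G.neighborFinset x).filter fun y => y ≠ o ∧ par y = x

/-- The lower ends of the edges which leave the finite set `R` downwards. -/
def legs (G : SimpleGraph W) [G.LocallyFinite] (o : W) (par : W → W) (R : Finset W) : Finset W :=
  R.biUnion (children G o par) \ R

/-- A finite set of vertices which contains the root and is closed under taking parents. -/
structure IsParentClosed (o : W) (par : W → W) (R : Finset W) : Prop where
  root_mem : o ∈ R
  par_mem : ∀ x ∈ R, x ≠ o → par x ∈ R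

variable {G : SimpleGraph W} [G.LocallyFinite] {o : W} {par : W → W} {dep : W → ℕ} {R : Finset W}

namespace IsRootedTree

theorem mem_children (h : IsRootedTree G o par dep) {x y : W} :
    y ∈ children G o par x ↔ y ≠ o ∧ par y = x := by
  simp only [children, Finset.mem_filter, SimpleGraph.mem_neighborFinset, h.adj_iff]
  tauto

theorem mem_legs (h : IsRootedTree G o par dep) {c : W} :
    c ∈ legs G o par R ↔ c ∉ R ∧ c ≠ o ∧ par c ∈ R := by
  simp only [legs, Finset.mem_sdiff, Finset.mem_biUnion, h.mem_children]
  constructor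
  · rintro ⟨⟨x, hx, hc, rfl⟩, hcR⟩
    exact ⟨hcR, hc, hx⟩
  · rintro ⟨hcR, hc, hx⟩
    exact ⟨⟨_, hx, hc, rfl⟩, hcR⟩

theorem degree_eq (h : IsRootedTree G o par dep) (x : W) :
    G.degree x = (children G o par x).card + if x = o then 0 else 1 := by
  have : G.neighborFinset x = children G o par x ∪ if x = o then ∅ else {par x} := by
    ext y
    rw [SimpleGraph.mem_neighborFinset, Finset.mem_union, h.mem_children, h.adj_iff]
    split_ifs with hx
    · simp [hx]
    · simp [hx]
      tauto
  rw [← SimpleGraph.card_neighborFinset_eq_degree, this, Finset.card_union_of_disjoint]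
  · split_ifs <;> simp
  · split_ifs with hx
    · simp
    · rw [Finset.disjoint_singleton_right, h.mem_children]
      rintro ⟨h1, h2⟩
      have h3 := h.dep_par x hx
      have h4 := h.dep_par _ h1
      rw [h2] at h4
      omega

/-- The edges at `x`, represented by their lower ends. -/
theorem degree_eq_card (h : IsRootedTree G o par dep) (x : W) :
    G.degree x = (children G o par x ∪ if x = o then ∅ else {x}).card := by
  rw [Finset.card_union_of_disjoint, h.degree_eq]
  · split_ifs <;> simp
  · split_ifs with hx
    · simp
    · rw [Finset.disjoint_singleton_right, h.mem_children]
      rintro ⟨-, h2⟩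
      exact h.par_ne_self hx h2

theorem mem_ball (h : IsRootedTree G o par dep) (n : ℕ) (x : W) :
    x ∈ ball G o n ↔ dep x ≤ n := by
  induction n generalizing x with
  | zero =>
    rw [ball, Finset.mem_singleton, Nat.le_zero]
    exact ⟨fun hx => hx ▸ h.dep_root, h.eq_root_of_dep_eq_zero⟩
  | succ n ih =>
    rw [ball, Finset.mem_union, Finset.mem_biUnion, ih]
    constructor
    · rintro (hx | ⟨y, hy, hyx⟩)
      · omega
      · rw [ih] at hy
        rw [SimpleGraph.mem_neighborFinset, h.adj_iff] at hyx
        rcases hyx with ⟨h1, rfl⟩ | ⟨h1, rfl⟩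
        · have := h.dep_par _ h1; omega
        · have := h.dep_par _ h1; omega
    · intro hx
      by_cases hxo : x = o
      · left; rw [hxo, h.dep_root]; omega
      · right
        have := h.dep_par _ hxo
        refine ⟨par x, (ih _).2 (by omega), ?_⟩
        rw [SimpleGraph.mem_neighborFinset, h.adj_iff]
        exact Or.inr ⟨hxo, rfl⟩

theorem isParentClosed_ball (h : IsRootedTree G o par dep) (n : ℕ) :
    IsParentClosed o par (ball G o n) where
  root_mem := by rw [h.mem_ball, h.dep_root]; omega
  par_mem x hx hxo := by
    rw [h.mem_ball] at hx ⊢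
    have := h.dep_par x hxo
    omega

/-- The next ball arises by adding all legs, so passing between balls reduces to adding one leg at a
time to a parent-closed region. -/
theorem ball_succ_eq (h : IsRootedTree G o par dep) (n : ℕ) :
    ball G o (n + 1) = ball G o n ∪ legs G o par (ball G o n) := by
  ext x
  rw [Finset.mem_union, h.mem_legs, h.mem_ball, h.mem_ball, h.mem_ball]
  by_cases hxo : x = o
  · simp [hxo, h.dep_root]
  · have := h.dep_par x hxo
    simp only [ne_eq, hxo, not_false_eq_true, true_and]
    omega

theorem isParentClosed_union (h : IsRootedTree G o par dep) (hR : IsParentClosed o par R)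
    {T : Finset W} (hT : T ⊆ legs G o par R) : IsParentClosed o par (R ∪ T) where
  root_mem := Finset.mem_union_left _ hR.root_mem
  par_mem x hx hxo := by
    rcases Finset.mem_union.1 hx with hx | hx
    · exact Finset.mem_union_left _ (hR.par_mem x hx hxo)
    · exact Finset.mem_union_left _ (h.mem_legs.1 (hT hx)).2.2

theorem legs_insert (h : IsRootedTree G o par dep) (hR : IsParentClosed o par R) {c : W}
    (hc : c ∈ legs G o par R) :
    legs G o par (insert c R) = (legs G o par R).erase c ∪ children G o par c := by
  rw [h.mem_legs] at hc
  ext x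
  rw [Finset.mem_union, Finset.mem_erase, h.mem_legs, h.mem_legs, h.mem_children]
  simp only [Finset.mem_insert]
  constructor
  · rintro ⟨h1, h2, h3⟩
    tauto
  · rintro (⟨h1, h2, h3, h4⟩ | ⟨h1, h2⟩)
    · tauto
    · refine ⟨?_, h1, Or.inl h2⟩
      rintro (h3 | h3)
      · exact h.par_ne_self h1 (h2.trans h3.symm)
      · exact hc.1 (h2 ▸ hR.par_mem x h3 h1)

theorem disjoint_legs_children (h : IsRootedTree G o par dep) {c : W}
    (hc : c ∈ legs G o par R) :
    Disjoint ((legs G o par R).erase c) (children G o par c) := by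
  rw [h.mem_legs] at hc
  rw [Finset.disjoint_left]
  intro x hx hx'
  rw [Finset.mem_erase, h.mem_legs] at hx
  rw [h.mem_children] at hx'
  exact hc.1 (hx'.2 ▸ hx.2.2.2)

end IsRootedTree

/-! ### Valence bond states with given boundary legs -/

open MvPolynomial

/-- The dehomogenised valence bond polynomial of the region `R`: a singlet on every edge inside `R`
and, among the legs, an up spin exactly at those in `η`. -/
def bondPoly (o : W) (par : W → W) (R η : Finset W) : MvPolynomial W ℝ :=
  (∏ c ∈ R.erase o, (X (par c) - X c)) * ∏ c ∈ η, X (par c)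

theorem degreeOf_bond_le (x p c : W) :
    degreeOf x (X p - X c : MvPolynomial W ℝ) ≤ if p = x ∨ c = x then 1 else 0 := by
  refine (degreeOf_sub_le _ _ _).trans ?_
  rw [degreeOf_X, degreeOf_X, max_le_iff]
  constructor
  · by_cases hx : x = p
    · simp [hx]
    · simp [hx]
  · by_cases hx : x = c
    · simp [hx]
    · simp [hx]

/-- Name every edge by its lower end. The remaining factors involving $X_x$ correspond to distinct
edges at $x$, and the edge named $c$ is not among them; so the degree is strictly smaller than that
of the vertex, which leaves room for the singlet on that edge. -/
theorem degreeOf_bondPoly_factor_lt (h : IsRootedTree G o par dep)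
    {η : Finset W} (hη : η ⊆ legs G o par R) {c x : W} (hc : c ∈ R.erase o)
    (hx : par c = x ∨ c = x) :
    degreeOf x ((∏ e ∈ (R.erase o).erase c, (X (par e) - X e)) * ∏ e ∈ η, X (par e) :
      MvPolynomial W ℝ) < G.degree x := by
  have hb : degreeOf x ((∏ e ∈ (R.erase o).erase c, (X (par e) - X e)) * ∏ e ∈ η, X (par e) :
      MvPolynomial W ℝ) ≤
      (((R.erase o).erase c).filter fun e => par e = x ∨ e = x).card +
        (η.filter fun e => par e = x).card := by
    refine (degreeOf_mul_le _ _ _).trans (add_le_add ?_ ?_)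
    · refine (degreeOf_prod_le _ _ _).trans ?_
      rw [Finset.card_filter]
      exact Finset.sum_le_sum fun e _ => degreeOf_bond_le x (par e) e
    · refine (degreeOf_prod_le _ _ _).trans ?_
      rw [Finset.card_filter]
      refine Finset.sum_le_sum fun e _ => ?_
      rw [degreeOf_X]
      simp only [eq_comm, le_refl]
  refine hb.trans_lt ?_
  rw [h.degree_eq_card, ← Finset.card_union_of_disjoint]
  · have hcm : c ∈ children G o par x ∪ if x = o then ∅ else {x} := by
      rw [Finset.mem_union, h.mem_children]
      have hco := Finset.ne_of_mem_erase hc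
      rcases hx with hx | hx
      · exact Or.inl ⟨hco, hx⟩
      · right; rw [if_neg (hx ▸ hco), Finset.mem_singleton, hx]
    refine Finset.card_lt_card ⟨?_, fun hsub => ?_⟩
    · intro e he
      simp only [Finset.mem_union, Finset.mem_filter, Finset.mem_erase] at he
      rw [Finset.mem_union, h.mem_children]
      rcases he with ⟨⟨-, heo, -⟩, he | he⟩ | ⟨he, he'⟩
      · exact Or.inl ⟨heo, he⟩
      · right; rw [if_neg (he ▸ heo), Finset.mem_singleton, he]
      · exact Or.inl ⟨(h.mem_legs.1 (hη he)).2.1, he'⟩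
    · have := hsub hcm
      simp only [Finset.mem_union, Finset.mem_filter, Finset.mem_erase] at this
      rcases this with ⟨⟨h1, -⟩, -⟩ | ⟨h1, -⟩
      · exact h1 rfl
      · exact (h.mem_legs.1 (hη h1)).1 (Finset.mem_of_mem_erase hc)
  · rw [Finset.disjoint_left]
    intro e he he'
    simp only [Finset.mem_filter, Finset.mem_erase] at he he'
    exact (h.mem_legs.1 (hη he'.1)).1 he.1.2.2

/-- The interaction of a vertex with its parent annihilates the valence bond states. -/
theorem pairProjection_mulVec_bondPoly (h : IsRootedTree G o par dep)
    {η : Finset W} (hη : η ⊆ legs G o par R) {x y : R} (hy : (y : W) ≠ o) (hxy : par y = x) :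
    (pairProjection G R x y).mulVec
      (fun σ => ((polyAmplitude R (bondPoly o par R η) σ : ℝ) : ℂ)) = 0 := by
  have hye : (y : W) ∈ R.erase o := Finset.mem_erase.2 ⟨hy, y.2⟩
  rw [bondPoly, ← Finset.mul_prod_erase _ _ hye, mul_assoc, hxy]
  refine pairProjection_mulVec_polyAmplitude ?_ ?_ ?_
  · rintro rfl
    exact h.par_ne_self hy hxy
  · exact degreeOf_bondPoly_factor_lt h hη hye (Or.inl hxy)
  · exact degreeOf_bondPoly_factor_lt h hη hye (Or.inr rfl)

/-! ### Product measures on leg spins and mixtures of valence bond states -/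

/-- The probability of the set `η` of up spins among the legs in `A`, which are independently up
with the probabilities `q`. -/
def legWeight (q : W → ℝ) (A η : Finset W) : ℝ :=
  (∏ i ∈ η, q i) * ∏ i ∈ A \ η, (1 - q i)

theorem legWeight_nonneg {q : W → ℝ} (h0 : ∀ x, 0 ≤ q x) (h1 : ∀ x, q x ≤ 1) (A η : Finset W) :
    0 ≤ legWeight q A η :=
  mul_nonneg (Finset.prod_nonneg fun i _ => h0 i)
    (Finset.prod_nonneg fun i _ => sub_nonneg.2 (h1 i))

/-- Expand $\prod_i(q_i+(1-q_i))=1$. -/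
theorem sum_legWeight (q : W → ℝ) (A : Finset W) : ∑ η ∈ A.powerset, legWeight q A η = 1 := by
  have := Finset.prod_add q (fun i => 1 - q i) A
  simp only [add_sub_cancel, Finset.prod_const_one] at this
  exact this.symm

theorem legWeight_insert_left (q : W → ℝ) {A η : Finset W} {c : W} (hc : c ∉ A) (hη : η ⊆ A) :
    legWeight q (insert c A) η = legWeight q A η * (1 - q c) := by
  rw [legWeight, legWeight, Finset.insert_sdiff_of_notMem _ (fun h' => hc (hη h')),
    Finset.prod_insert (by simp [hc])]
  ring

theorem legWeight_insert_insert (q : W → ℝ) {A η : Finset W} {c : W} (hc : c ∉ A) (hη : η ⊆ A) :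
    legWeight q (insert c A) (insert c η) = legWeight q A η * q c := by
  rw [legWeight, legWeight, Finset.insert_sdiff_insert, Finset.sdiff_insert_of_notMem hc,
    Finset.prod_insert (fun h' => hc (hη h'))]
  ring

theorem legWeight_union (q : W → ℝ) {A B η κ : Finset W} (hAB : Disjoint A B) (hη : η ⊆ A)
    (hκ : κ ⊆ B) : legWeight q (A ∪ B) (η ∪ κ) = legWeight q A η * legWeight q B κ := by
  have h1 : (A ∪ B) \ (η ∪ κ) = (A \ η) ∪ (B \ κ) := by
    ext x
    have := fun hx : x ∈ A => Finset.disjoint_left.1 hAB hx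
    have := fun hx : x ∈ η => hη hx
    have := fun hx : x ∈ κ => hκ hx
    simp only [Finset.mem_sdiff, Finset.mem_union]
    tauto
  rw [legWeight, legWeight, legWeight, h1, Finset.prod_union (hAB.mono hη hκ),
    Finset.prod_union (hAB.mono Finset.sdiff_subset Finset.sdiff_subset)]
  ring

theorem sum_powerset_union {M : Type*} [AddCommMonoid M] {A B : Finset W} (hAB : Disjoint A B)
    (f : Finset W → M) :
    ∑ η ∈ (A ∪ B).powerset, f η = ∑ η ∈ A.powerset, ∑ κ ∈ B.powerset, f (η ∪ κ) := by
  rw [← Finset.sum_product']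
  symm
  refine Finset.sum_bij' (fun p _ => p.1 ∪ p.2) (fun η _ => (η ∩ A, η ∩ B)) ?_ ?_ ?_ ?_ ?_
  · rintro ⟨a, b⟩ hab
    simp only [Finset.mem_product, Finset.mem_powerset] at hab ⊢
    exact Finset.union_subset_union hab.1 hab.2
  · intro η _
    simp
  · rintro ⟨a, b⟩ hab
    simp only [Finset.mem_product, Finset.mem_powerset] at hab
    ext x
    · have := fun hx : x ∈ A => Finset.disjoint_left.1 hAB hx
      have := fun hx : x ∈ a => hab.1 hx
      have := fun hx : x ∈ b => hab.2 hx
      simp only [Finset.mem_inter, Finset.mem_union]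
      tauto
    · have := fun hx : x ∈ A => Finset.disjoint_left.1 hAB hx
      have := fun hx : x ∈ a => hab.1 hx
      have := fun hx : x ∈ b => hab.2 hx
      simp only [Finset.mem_inter, Finset.mem_union]
      tauto
  · intro η hη
    simp only [Finset.mem_powerset] at hη
    rw [← Finset.inter_union_distrib_left, Finset.inter_eq_left.2 hη]
  · intros; rfl

/-- The unnormalised mixture of the valence bond states of `R` in which the legs are independently
up with the probabilities `q`. -/
def bondMixture (G : SimpleGraph W) [G.LocallyFinite] (o : W) (par : W → W) (q : W → ℝ)
    (R : Finset W) : Obs G R := fun σ τ =>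
  ((∑ η ∈ (legs G o par R).powerset, legWeight q (legs G o par R) η *
    (polyAmplitude R (bondPoly o par R η) σ * polyAmplitude R (bondPoly o par R η) τ) : ℝ) : ℂ)

theorem bondMixture_eq_sum (q : W → ℝ) :
    bondMixture G o par q R = ∑ η ∈ (legs G o par R).powerset,
      ((legWeight q (legs G o par R) η : ℝ) : ℂ) • Matrix.vecMulVec
        (fun σ : Config G R => ((polyAmplitude R (bondPoly o par R η) σ : ℝ) : ℂ))
        (star fun σ : Config G R => ((polyAmplitude R (bondPoly o par R η) σ : ℝ) : ℂ)) := by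
  ext σ τ
  rw [Matrix.sum_apply, bondMixture]
  push_cast
  refine Finset.sum_congr rfl fun η _ => ?_
  simp [Matrix.vecMulVec_apply]

theorem posSemidef_bondMixture {q : W → ℝ} (h0 : ∀ x, 0 ≤ q x) (h1 : ∀ x, q x ≤ 1) :
    (bondMixture G o par q R).PosSemidef := by
  rw [bondMixture_eq_sum]
  refine Matrix.posSemidef_sum _ fun η _ => ?_
  refine (Matrix.posSemidef_vecMulVec_self_star _).smul ?_
  exact_mod_cast legWeight_nonneg h0 h1 _ _

theorem hamiltonian_mul_bondMixture (h : IsRootedTree G o par dep) (q : W → ℝ) :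
    hamiltonian G R * bondMixture G o par q R = 0 := by
  rw [bondMixture_eq_sum, hamiltonian, Finset.sum_mul_sum]
  refine Finset.sum_eq_zero fun e he => Finset.sum_eq_zero fun η hη => ?_
  rw [Finset.mem_powerset] at hη
  rw [mul_smul_comm, Matrix.mul_vecMulVec]
  suffices hs : (Sym2.lift ⟨pairProjection G R, pairProjection_symm G R⟩ e).mulVec
      (fun σ => ((polyAmplitude R (bondPoly o par R η) σ : ℝ) : ℂ)) = 0 by
    rw [hs, Matrix.zero_vecMulVec, smul_zero]
  induction e using Sym2.ind with
  | _ x y =>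
    rw [SimpleGraph.mem_edgeFinset, SimpleGraph.mem_edgeSet, SimpleGraph.comap_adj,
      h.adj_iff] at he
    change (pairProjection G R x y).mulVec _ = 0
    rcases he with ⟨h1, h2⟩ | ⟨h1, h2⟩
    · rw [pairProjection_symm]
      exact pairProjection_mulVec_bondPoly h hη h1 h2
    · exact pairProjection_mulVec_bondPoly h hη h1 h2

end RootedTree

/-! ### Removing a vertex from the region -/

section Consistency

variable {W : Type*} {G : SimpleGraph W} [G.LocallyFinite] {R : Finset W}

/-- The vertex `c` as a site of `insert c R`. -/
abbrev newSite (c : W) (R : Finset W) : (insert c R : Finset W) := ⟨c, Finset.mem_insert_self c R⟩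

/-- The configuration of `insert c R` with restriction `σ` to `R` and value `s` at `c`. -/
def glueConfig {c : W} (σ : Config G R) (s : Fin (G.degree c + 1)) : Config G (insert c R) :=
  Function.update (fun x => if hx : (x : W) ∈ R then σ ⟨x, hx⟩ else 0) (newSite c R) s

theorem glueConfig_newSite {c : W} (σ : Config G R) (s : Fin (G.degree c + 1)) :
    glueConfig σ s (newSite c R) = s := by
  simp [glueConfig]

theorem glueConfig_of_mem {c : W} (hc : c ∉ R) (σ : Config G R) (s : Fin (G.degree c + 1))
    {x : W} (hx : x ∈ R) : glueConfig σ s ⟨x, Finset.mem_insert_of_mem hx⟩ = σ ⟨x, hx⟩ := by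
  rw [glueConfig, Function.update_of_ne, dif_pos hx]
  intro h'
  have hxc : x = c := congrArg Subtype.val h'
  exact hc (hxc ▸ hx)

/-- Configurations of `insert c R` are pairs of a configuration of `R` and a value at `c`. -/
def glueEquiv {c : W} (hc : c ∉ R) :
    Config G R × Fin (G.degree c + 1) ≃ Config G (insert c R) where
  toFun p := glueConfig p.1 p.2
  invFun σ := (fun x => σ ⟨x, Finset.mem_insert_of_mem x.2⟩, σ (newSite c R))
  left_inv := by
    rintro ⟨σ, s⟩
    refine Prod.ext ?_ (glueConfig_newSite σ s)
    ext1 x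
    exact glueConfig_of_mem hc σ s x.2
  right_inv := by
    intro σ
    ext1 ⟨x, hx⟩
    rcases Finset.mem_insert.1 hx with rfl | hx'
    · exact glueConfig_newSite _ _
    · exact glueConfig_of_mem hc _ _ hx'

theorem configExponent_glueConfig {c : W} (hc : c ∉ R) (σ : Config G R)
    (s : Fin (G.degree c + 1)) :
    configExponent (glueConfig σ s) = configExponent σ + Finsupp.single c (s : ℕ) := by
  ext x
  rw [Finsupp.add_apply]
  by_cases hx : x ∈ R
  · rw [configExponent_coe _ ⟨x, Finset.mem_insert_of_mem hx⟩, configExponent_coe σ ⟨x, hx⟩,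
      glueConfig_of_mem hc, Finsupp.single_eq_of_ne, add_zero]
    rintro rfl
    exact hc hx
  · rw [configExponent_of_notMem σ hx]
    by_cases hxc : x = c
    · subst hxc
      refine (configExponent_coe _ (newSite x R)).trans ?_
      rw [glueConfig_newSite, Finsupp.single_eq_same, zero_add]
    · rw [configExponent_of_notMem _ (by simp [hx, hxc]), Finsupp.single_eq_of_ne hxc,
        add_zero]

theorem configWeight_glueConfig {c : W} (hc : c ∉ R) (σ : Config G R)
    (s : Fin (G.degree c + 1)) :
    configWeight (glueConfig σ s) = configWeight σ *
      ((Nat.factorial s * Nat.factorial (G.degree c - s) : ℕ) : ℝ) := by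
  have key : ∀ f : (∀ x : (insert c R : Finset W), ℝ), ∏ x, f x =
      f (newSite c R) * ∏ x : R, f ⟨x, Finset.mem_insert_of_mem x.2⟩ := by
    intro f
    -- The function is defined on sites of `insert c R` only; extending it by $1$ allows the
    -- products to be compared over plain finite sets.
    have h1 := Finset.prod_attach (insert c R)
      (fun x => if hx : x ∈ insert c R then f ⟨x, hx⟩ else 1)
    have h2 := Finset.prod_attach R
      (fun x => if hx : x ∈ insert c R then f ⟨x, hx⟩ else 1)
    rw [Finset.prod_insert hc, ← h2, dif_pos (Finset.mem_insert_self c R)] at h1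
    rw [← Finset.attach_eq_univ, ← Finset.attach_eq_univ]
    convert h1 using 2
    · simp
    · refine Finset.prod_congr rfl fun x _ => ?_
      rw [dif_pos (Finset.mem_insert_of_mem x.2)]
  rw [configWeight, key, glueConfig_newSite, mul_comm]
  congr 1
  refine Finset.prod_congr rfl fun x _ => ?_
  rw [glueConfig_of_mem hc σ s x.2]

/-- An observable of $S\not\ni c$ acts as the identity at $c$, which turns the trace over the larger
region into a partial trace over $c$. -/
theorem extendObs_glueConfig {S : Finset W} {c : W} (hc : c ∉ R) (hS : S ⊆ R)
    (hS' : S ⊆ insert c R) (A : Obs G S) (σ τ : Config G R) (s t : Fin (G.degree c + 1)) :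
    extendObs hS' A (glueConfig σ s) (glueConfig τ t) =
      if s = t then extendObs hS A σ τ else 0 := by
  simp only [extendObs]
  have h1 : (∀ z : (insert c R : Finset W), (z : W) ∉ S → glueConfig σ s z = glueConfig τ t z) ↔
      s = t ∧ ∀ z : R, (z : W) ∉ S → σ z = τ z := by
    constructor
    · intro h'
      refine ⟨?_, fun z hz => ?_⟩
      · have := h' (newSite c R) (fun h'' => hc (hS h''))
        rwa [glueConfig_newSite, glueConfig_newSite] at this
      · have := h' ⟨z, Finset.mem_insert_of_mem z.2⟩ hz
        rwa [glueConfig_of_mem hc, glueConfig_of_mem hc] at this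
    · rintro ⟨rfl, h'⟩ ⟨z, hz⟩ hzS
      rcases Finset.mem_insert.1 hz with rfl | hz'
      · exact (glueConfig_newSite σ s).trans (glueConfig_newSite τ s).symm
      · rw [glueConfig_of_mem hc σ s hz', glueConfig_of_mem hc τ s hz']
        exact h' _ hzS
  have h2 : ∀ (ρ : Config G R) (r : Fin (G.degree c + 1)),
      (fun x : S => glueConfig ρ r ⟨x, hS' x.2⟩) = fun x : S => ρ ⟨x, hS x.2⟩ :=
    fun ρ r => funext fun x => glueConfig_of_mem hc ρ r (hS x.2)
  simp only [h1, h2, ite_and]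

/-- If tracing out the site `c` maps `ρ'` to `κ • ρ`, then so do the expectations. -/
theorem trace_mul_extendObs_insert {S : Finset W} {c : W} (hc : c ∉ R) (hS : S ⊆ R)
    (hS' : S ⊆ insert c R) (A : Obs G S) (ρ' : Obs G (insert c R)) (ρ : Obs G R) (κ : ℂ)
    (hρ : ∀ σ τ, ∑ s, ρ' (glueConfig σ s) (glueConfig τ s) = κ * ρ σ τ) :
    (ρ' * extendObs hS' A).trace = κ * (ρ * extendObs hS A).trace := by
  simp only [Matrix.trace, Matrix.diag_apply, Matrix.mul_apply]
  rw [← (glueEquiv (G := G) hc).sum_comp]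
  have h1 : ∀ p : Config G R × Fin (G.degree c + 1),
      ∑ τ', ρ' (glueEquiv hc p) τ' * extendObs hS' A τ' (glueEquiv hc p) =
        ∑ τ, ρ' (glueConfig p.1 p.2) (glueConfig τ p.2) * extendObs hS A τ p.1 := by
    intro p
    rw [← (glueEquiv (G := G) hc).sum_comp, Fintype.sum_prod_type]
    refine Finset.sum_congr rfl fun τ _ => ?_
    simp only [glueEquiv, Equiv.coe_fn_mk, extendObs_glueConfig hc hS, mul_ite, mul_zero,
      Finset.sum_ite_eq', Finset.mem_univ, if_true]
  rw [Finset.sum_congr rfl fun p _ => h1 p, Fintype.sum_prod_type, Finset.mul_sum]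
  refine Finset.sum_congr rfl fun σ _ => ?_
  rw [Finset.sum_comm, Finset.mul_sum]
  refine Finset.sum_congr rfl fun τ _ => ?_
  rw [← mul_assoc, ← hρ, Finset.sum_mul]

/-! ### Amplitudes after adding one vertex -/

open MvPolynomial

theorem coeff_add_single_X_pow_mul {c : W} {P : MvPolynomial W ℝ} (hP : degreeOf c P = 0)
    {e : W →₀ ℕ} (he : e c = 0) (s j : ℕ) :
    coeff (e + Finsupp.single c s) (X c ^ j * P) = if s = j then coeff e P else 0 := by
  rw [X_pow_eq_monomial, coeff_monomial_mul', one_mul]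
  have hle : Finsupp.single c j ≤ e + Finsupp.single c s ↔ j ≤ s := by
    rw [Finsupp.single_le_iff]
    simp [he]
  simp only [hle]
  split_ifs with h1 h2 h2
  · subst h2
    rw [add_tsub_cancel_right]
  · apply coeff_eq_zero_of_degreeOf_lt (x := c)
    rw [hP]
    simp [he]
    omega
  · omega
  · rfl

theorem polyAmplitude_glueConfig_X_pow_mul {c : W} (hc : c ∉ R) {P : MvPolynomial W ℝ}
    (hP : degreeOf c P = 0) (σ : Config G R) (s : Fin (G.degree c + 1)) (j : ℕ) :
    polyAmplitude (insert c R) (X c ^ j * P) (glueConfig σ s) =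
      if (s : ℕ) = j then polyAmplitude R P σ *
        Real.sqrt ((Nat.factorial j * Nat.factorial (G.degree c - j) : ℕ) : ℝ) else 0 := by
  rw [polyAmplitude, configExponent_glueConfig hc,
    coeff_add_single_X_pow_mul hP (configExponent_of_notMem σ hc), configWeight_glueConfig hc]
  split_ifs with h
  · rw [Real.sqrt_mul (configWeight_pos σ).le, h, polyAmplitude, mul_assoc]
  · rw [zero_mul]

/-- The powers $X_c^k$ and $X_c^{k+1}$ are orthogonal at the site $c$, so the partial trace has no
cross terms between $P$ and $Q$. The bound on $k$ makes both exponents admissible spin values at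
$c$. -/
theorem sum_glueConfig_amplitude {c : W} (hc : c ∉ R) {P Q : MvPolynomial W ℝ}
    (hP : degreeOf c P = 0) (hQ : degreeOf c Q = 0) {k : ℕ} (hk : k < G.degree c)
    (σ τ : Config G R) :
    ∑ s, polyAmplitude (insert c R) (X c ^ k * P - X c ^ (k + 1) * Q) (glueConfig σ s) *
        polyAmplitude (insert c R) (X c ^ k * P - X c ^ (k + 1) * Q) (glueConfig τ s) =
      ((Nat.factorial k * Nat.factorial (G.degree c - k) : ℕ) : ℝ) *
          (polyAmplitude R P σ * polyAmplitude R P τ) +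
        ((Nat.factorial (k + 1) * Nat.factorial (G.degree c - (k + 1)) : ℕ) : ℝ) *
          (polyAmplitude R Q σ * polyAmplitude R Q τ) := by
  simp only [polyAmplitude_sub, polyAmplitude_glueConfig_X_pow_mul hc hP,
    polyAmplitude_glueConfig_X_pow_mul hc hQ]
  generalize ha : ((Nat.factorial k * Nat.factorial (G.degree c - k) : ℕ) : ℝ) = a
  generalize hb : ((Nat.factorial (k + 1) * Nat.factorial (G.degree c - (k + 1)) : ℕ) : ℝ) = b
  have ha0 : Real.sqrt a * Real.sqrt a = a :=
    Real.mul_self_sqrt (by rw [← ha]; exact Nat.cast_nonneg _)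
  have hb0 : Real.sqrt b * Real.sqrt b = b :=
    Real.mul_self_sqrt (by rw [← hb]; exact Nat.cast_nonneg _)
  have key : ∀ s : Fin (G.degree c + 1),
      ((if (s : ℕ) = k then polyAmplitude R P σ * Real.sqrt a else 0) -
          (if (s : ℕ) = k + 1 then polyAmplitude R Q σ * Real.sqrt b else 0)) *
        ((if (s : ℕ) = k then polyAmplitude R P τ * Real.sqrt a else 0) -
          (if (s : ℕ) = k + 1 then polyAmplitude R Q τ * Real.sqrt b else 0)) =
      (if s = ⟨k, by omega⟩ then a * (polyAmplitude R P σ * polyAmplitude R P τ) else 0) +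
        (if s = ⟨k + 1, by omega⟩ then b * (polyAmplitude R Q σ * polyAmplitude R Q τ) else 0) := by
    intro s
    simp only [Fin.ext_iff]
    split_ifs with h1 h2 h2
    · omega
    · linear_combination (polyAmplitude R P σ * polyAmplitude R P τ) * ha0
    · linear_combination (polyAmplitude R Q σ * polyAmplitude R Q τ) * hb0
    · ring
  rw [Finset.sum_congr rfl fun s _ => key s, Finset.sum_add_distrib, Finset.sum_ite_eq',
    Finset.sum_ite_eq', if_pos (Finset.mem_univ _), if_pos (Finset.mem_univ _)]

variable {o : W} {par : W → W} {dep : W → ℕ}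

theorem degreeOf_bondPoly_eq_zero (h : IsRootedTree G o par dep) (hR : IsParentClosed o par R)
    {η : Finset W} (hη : η ⊆ legs G o par R) {c : W} (hc : c ∉ R) :
    degreeOf c (bondPoly o par R η) = 0 := by
  rw [← Nat.le_zero, bondPoly]
  refine (degreeOf_mul_le _ _ _).trans ?_
  rw [Nat.le_zero, Nat.add_eq_zero_iff]
  constructor
  · rw [← Nat.le_zero]
    refine (degreeOf_prod_le _ _ _).trans ?_
    rw [Nat.le_zero]
    refine Finset.sum_eq_zero fun e he => ?_
    rw [Finset.mem_erase] at he
    refine Nat.le_zero.1 ((degreeOf_bond_le _ _ _).trans ?_)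
    rw [if_neg]
    rintro (h' | h')
    · exact hc (h' ▸ hR.par_mem e he.2 he.1)
    · exact hc (h' ▸ he.2)
  · rw [← Nat.le_zero]
    refine (degreeOf_prod_le _ _ _).trans ?_
    rw [Nat.le_zero]
    refine Finset.sum_eq_zero fun e he => ?_
    rw [degreeOf_X, if_neg]
    intro h'
    exact hc (h' ▸ (h.mem_legs.1 (hη he)).2.2)

/-- Expand the new singlet factor $X_{\mathrm{par}\,c}-X_c$: either the upper end is up, so that $c$
becomes an up leg of $R$, or the lower end is up and contributes one more power of $X_c$. The
children in $\kappa$ contribute $X_c^{|\kappa|}$. -/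
theorem bondPoly_insert (h : IsRootedTree G o par dep)
    {c : W} (hc : c ∈ legs G o par R) {η κ : Finset W} (hη : η ⊆ (legs G o par R).erase c)
    (hκ : κ ⊆ children G o par c) :
    bondPoly o par (insert c R) (η ∪ κ) =
      X c ^ κ.card * bondPoly o par R (insert c η) -
        X c ^ (κ.card + 1) * bondPoly o par R η := by
  have hcη : c ∉ η := fun h' => by simpa using hη h'
  have hd : Disjoint η κ := (h.disjoint_legs_children hc).mono hη hκ
  have hκ' : ∏ e ∈ κ, (X (par e) : MvPolynomial W ℝ) = X c ^ κ.card := by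
    rw [← Finset.prod_const]
    refine Finset.prod_congr rfl fun e he => ?_
    rw [(h.mem_children.1 (hκ he)).2]
  have hc' := h.mem_legs.1 hc
  rw [bondPoly, bondPoly, bondPoly, Finset.prod_union hd, hκ', Finset.prod_insert hcη,
    Finset.erase_insert_of_ne hc'.2.1, Finset.prod_insert]
  · ring
  · intro hmem
    exact hc'.1 (Finset.mem_of_mem_erase hmem)

/-- The weight of an up spin sent to the parent by a vertex with the legs in `K`. -/
def upWeight (q : W → ℝ) (K : Finset W) : ℝ :=
  ∑ κ ∈ K.powerset, legWeight q K κ *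
    ((Nat.factorial κ.card * Nat.factorial (K.card + 1 - κ.card) : ℕ) : ℝ)

/-- The weight of a down spin sent to the parent by a vertex with the legs in `K`. -/
def downWeight (q : W → ℝ) (K : Finset W) : ℝ :=
  ∑ κ ∈ K.powerset, legWeight q K κ *
    ((Nat.factorial (κ.card + 1) * Nat.factorial (K.card - κ.card) : ℕ) : ℝ)

/-- The probabilities `q` are consistent: the leg above `c` is up with the probability obtained by
tracing out the vertex `c` with the legs below it. -/
def IsConsistent (G : SimpleGraph W) [G.LocallyFinite] (o : W) (par : W → W) (q : W → ℝ) : Prop :=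
  ∀ c, c ≠ o → upWeight q (children G o par c) =
    (upWeight q (children G o par c) + downWeight q (children G o par c)) * q c

/-- The legs other than $c$ factor out. Summing over the children of $c$ leaves the weights
`upWeight` and `downWeight` for the leg $c$, and consistency says that they are proportional to
$q_c$ and $1-q_c$. -/
theorem sum_bondMixture_glueConfig (h : IsRootedTree G o par dep) (hR : IsParentClosed o par R)
    {q : W → ℝ} (hq : IsConsistent G o par q) {c : W} (hc : c ∈ legs G o par R)
    (σ τ : Config G R) :
    ∑ s, bondMixture G o par q (insert c R) (glueConfig σ s) (glueConfig τ s) =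
      ((upWeight q (children G o par c) + downWeight q (children G o par c) : ℝ) : ℂ) *
        bondMixture G o par q R σ τ := by
  have hc' := h.mem_legs.1 hc
  simp only [bondMixture]
  rw [← Complex.ofReal_sum, ← Complex.ofReal_mul]
  congr 1
  rw [Finset.sum_comm, h.legs_insert hR hc, sum_powerset_union (h.disjoint_legs_children hc)]
  have hcE : c ∉ (legs G o par R).erase c := by simp
  have hdeg : G.degree c = (children G o par c).card + 1 := by
    rw [h.degree_eq, if_neg hc'.2.1]
  -- The sum over leg spins of $R$ is split according to whether the leg $c$ is down or up.
  have hl : ∀ f : Finset W → ℝ, ∑ η ∈ (legs G o par R).powerset, f η =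
      ∑ η ∈ ((legs G o par R).erase c).powerset, (f η + f (insert c η)) := by
    intro f
    conv_lhs => rw [← Finset.insert_erase hc]
    rw [Finset.sum_powerset_insert hcE, Finset.sum_add_distrib]
  rw [hl, Finset.mul_sum]
  refine Finset.sum_congr rfl fun η hη => ?_
  rw [Finset.mem_powerset] at hη
  have hη' : η ⊆ legs G o par R := hη.trans (Finset.erase_subset _ _)
  have hw1 : legWeight q (legs G o par R) η =
      legWeight q ((legs G o par R).erase c) η * (1 - q c) := by
    rw [← legWeight_insert_left q hcE hη, Finset.insert_erase hc]
  have hw2 : legWeight q (legs G o par R) (insert c η) =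
      legWeight q ((legs G o par R).erase c) η * q c := by
    rw [← legWeight_insert_insert q hcE hη, Finset.insert_erase hc]
  rw [hw1, hw2]
  have hsum : ∀ κ ∈ (children G o par c).powerset,
      ∑ s, legWeight q ((legs G o par R).erase c ∪ children G o par c) (η ∪ κ) *
        (polyAmplitude (insert c R) (bondPoly o par (insert c R) (η ∪ κ)) (glueConfig σ s) *
          polyAmplitude (insert c R) (bondPoly o par (insert c R) (η ∪ κ)) (glueConfig τ s)) =
      legWeight q ((legs G o par R).erase c) η * ((polyAmplitude R (bondPoly o par R (insert c η)) σ *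
          polyAmplitude R (bondPoly o par R (insert c η)) τ) *
        (legWeight q (children G o par c) κ *
          ((Nat.factorial κ.card *
            Nat.factorial ((children G o par c).card + 1 - κ.card) : ℕ) : ℝ)) +
        (polyAmplitude R (bondPoly o par R η) σ * polyAmplitude R (bondPoly o par R η) τ) *
        (legWeight q (children G o par c) κ * ((Nat.factorial (κ.card + 1) *
          Nat.factorial ((children G o par c).card - κ.card) : ℕ) : ℝ))) := by
    intro κ hκ
    rw [Finset.mem_powerset] at hκ
    have hk : κ.card < G.degree c := by
      rw [hdeg]; exact Nat.lt_succ_of_le (Finset.card_le_card hκ)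
    have hins : insert c η ⊆ legs G o par R := Finset.insert_subset hc hη'
    rw [← Finset.mul_sum, bondPoly_insert h hc hη hκ, sum_glueConfig_amplitude hc'.1
      (degreeOf_bondPoly_eq_zero h hR hins hc'.1) (degreeOf_bondPoly_eq_zero h hR hη' hc'.1) hk,
      legWeight_union q (h.disjoint_legs_children hc) hη hκ, hdeg, Nat.add_sub_add_right]
    ring
  rw [Finset.sum_congr rfl hsum, ← Finset.mul_sum, Finset.sum_add_distrib, ← Finset.mul_sum,
    ← Finset.mul_sum]
  change _ * (_ * upWeight q (children G o par c) + _ * downWeight q (children G o par c)) = _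
  have hqc := hq c hc'.2.1
  linear_combination legWeight q ((legs G o par R).erase c) η *
    (polyAmplitude R (bondPoly o par R (insert c η)) σ *
      polyAmplitude R (bondPoly o par R (insert c η)) τ -
    polyAmplitude R (bondPoly o par R η) σ * polyAmplitude R (bondPoly o par R η) τ) * hqc

end Consistency

/-! ### The magnetisation of the legs -/

section Legs

variable {W : Type*}

/-- The partition function of a vertex without parent and with the legs in `K`, the leg `x` having
the magnetisation `m x`. -/
def legMass (m : W → ℝ) (K : Finset W) : ℝ :=
  ∑ κ ∈ K.powerset, legWeight (fun x => (1 + m x) / 2) K κ *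
    ((Nat.factorial κ.card * Nat.factorial (K.card - κ.card) : ℕ) : ℝ)

/-- The unnormalised magnetisation of a vertex without parent and with the legs in `K`, the leg `x`
having the magnetisation `m x`. -/
def legMoment (m : W → ℝ) (K : Finset W) : ℝ :=
  ∑ κ ∈ K.powerset, legWeight (fun x => (1 + m x) / 2) K κ *
    (((Nat.factorial κ.card * Nat.factorial (K.card - κ.card) : ℕ) : ℝ) *
      (2 * (κ.card : ℝ) - K.card))

theorem legWeight_congr {p q : W → ℝ} {K κ : Finset W} (hκ : κ ⊆ K)
    (h : ∀ x ∈ K, p x = q x) : legWeight p K κ = legWeight q K κ := by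
  rw [legWeight, legWeight, Finset.prod_congr rfl fun x hx => h x (hκ hx)]
  congr 1
  refine Finset.prod_congr rfl fun x hx => ?_
  rw [h x (Finset.mem_sdiff.1 hx).1]

theorem legMass_congr {m n : W → ℝ} {K : Finset W} (h : ∀ x ∈ K, m x = n x) :
    legMass m K = legMass n K := by
  refine Finset.sum_congr rfl fun κ hκ => ?_
  rw [legWeight_congr (Finset.mem_powerset.1 hκ) fun x hx => by rw [h x hx]]

theorem legMoment_congr {m n : W → ℝ} {K : Finset W} (h : ∀ x ∈ K, m x = n x) :
    legMoment m K = legMoment n K := by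
  refine Finset.sum_congr rfl fun κ hκ => ?_
  rw [legWeight_congr (Finset.mem_powerset.1 hκ) fun x hx => by rw [h x hx]]

/-- Reversing all magnetisations exchanges up and down legs. This symmetry makes `legMass` even and
`legMoment` odd. -/
theorem legWeight_neg (m : W → ℝ) {K κ : Finset W} (hκ : κ ⊆ K) :
    legWeight (fun x => (1 + -m x) / 2) K κ = legWeight (fun x => (1 + m x) / 2) K (K \ κ) := by
  rw [legWeight, legWeight, Finset.sdiff_sdiff_eq_self hκ, mul_comm]
  congr 1 <;> exact Finset.prod_congr rfl fun x _ => by ring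

theorem sum_powerset_sdiff (K : Finset W) (f : Finset W → ℝ) :
    ∑ κ ∈ K.powerset, f (K \ κ) = ∑ κ ∈ K.powerset, f κ := by
  refine Finset.sum_bij' (fun κ _ => K \ κ) (fun κ _ => K \ κ) ?_ ?_ ?_ ?_ ?_
  · intro κ _; simp
  · intro κ _; simp
  · intro κ hκ; exact Finset.sdiff_sdiff_eq_self (Finset.mem_powerset.1 hκ)
  · intro κ hκ; exact Finset.sdiff_sdiff_eq_self (Finset.mem_powerset.1 hκ)
  · intros; rfl

theorem card_sdiff_cast {K κ : Finset W} (hκ : κ ⊆ K) :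
    ((K \ κ).card : ℝ) = (K.card : ℝ) - κ.card := by
  rw [Finset.card_sdiff_of_subset hκ, Nat.cast_sub (Finset.card_le_card hκ)]

theorem legMass_neg (m : W → ℝ) (K : Finset W) : legMass (fun x => -m x) K = legMass m K := by
  rw [legMass, legMass, ← sum_powerset_sdiff]
  refine Finset.sum_congr rfl fun κ hκ => ?_
  rw [Finset.mem_powerset] at hκ
  rw [legWeight_neg m Finset.sdiff_subset, Finset.sdiff_sdiff_eq_self hκ,
    Finset.card_sdiff_of_subset hκ, Nat.sub_sub_self (Finset.card_le_card hκ), mul_comm (Nat.factorial κ.card)]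

theorem legMoment_neg (m : W → ℝ) (K : Finset W) :
    legMoment (fun x => -m x) K = -legMoment m K := by
  rw [legMoment, legMoment, ← sum_powerset_sdiff, ← Finset.sum_neg_distrib]
  refine Finset.sum_congr rfl fun κ hκ => ?_
  rw [Finset.mem_powerset] at hκ
  rw [legWeight_neg m Finset.sdiff_subset, Finset.sdiff_sdiff_eq_self hκ, card_sdiff_cast hκ,
    Finset.card_sdiff_of_subset hκ, Nat.sub_sub_self (Finset.card_le_card hκ)]
  push_cast
  ring

/-- Termwise, $k!\,(l+1)!+(k+1)!\,l!=(k+l+2)\,k!\,l!$ with $k+l=|K|$; the difference of the same two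
terms gives `legMoment`. -/
theorem upWeight_add_downWeight (m : W → ℝ) (K : Finset W) :
    upWeight (fun x => (1 + m x) / 2) K + downWeight (fun x => (1 + m x) / 2) K =
      ((K.card : ℝ) + 2) * legMass m K := by
  rw [upWeight, downWeight, legMass, ← Finset.sum_add_distrib, Finset.mul_sum]
  refine Finset.sum_congr rfl fun κ hκ => ?_
  rw [Finset.mem_powerset] at hκ
  obtain ⟨l, hl⟩ := Nat.exists_eq_add_of_le (Finset.card_le_card hκ)
  rw [hl, show κ.card + l + 1 - κ.card = l + 1 by omega, show κ.card + l - κ.card = l by omega,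
    Nat.factorial_succ, Nat.factorial_succ]
  push_cast
  ring

theorem downWeight_sub_upWeight (m : W → ℝ) (K : Finset W) :
    downWeight (fun x => (1 + m x) / 2) K - upWeight (fun x => (1 + m x) / 2) K =
      legMoment m K := by
  rw [upWeight, downWeight, legMoment, ← Finset.sum_sub_distrib]
  refine Finset.sum_congr rfl fun κ hκ => ?_
  rw [Finset.mem_powerset] at hκ
  obtain ⟨l, hl⟩ := Nat.exists_eq_add_of_le (Finset.card_le_card hκ)
  rw [hl, show κ.card + l + 1 - κ.card = l + 1 by omega, show κ.card + l - κ.card = l by omega,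
    Nat.factorial_succ, Nat.factorial_succ]
  push_cast
  ring

/-- The weights form a probability distribution and all factorials are at least $1$. Positivity is
what makes the response well defined and continuous. -/
theorem one_le_legMass {m : W → ℝ} {K : Finset W} (hm : ∀ x ∈ K, |m x| ≤ 1) :
    1 ≤ legMass m K := by
  rw [← sum_legWeight (fun x => (1 + m x) / 2) K, legMass]
  refine Finset.sum_le_sum fun κ hκ => ?_
  rw [Finset.mem_powerset] at hκ
  refine le_mul_of_one_le_right ?_ ?_
  · refine mul_nonneg (Finset.prod_nonneg fun x hx => ?_) (Finset.prod_nonneg fun x hx => ?_)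
    · have := abs_le.1 (hm x (hκ hx)); linarith
    · have := abs_le.1 (hm x (Finset.mem_sdiff.1 hx).1); linarith
  · exact_mod_cast Nat.mul_pos (Nat.factorial_pos _) (Nat.factorial_pos _)

theorem abs_legMoment_le {m : W → ℝ} {K : Finset W} (hm : ∀ x ∈ K, |m x| ≤ 1) :
    |legMoment m K| ≤ ((K.card : ℝ) + 2) * legMass m K := by
  rw [legMoment, legMass, Finset.mul_sum]
  refine (Finset.abs_sum_le_sum_abs _ _).trans (Finset.sum_le_sum fun κ hκ => ?_)
  rw [Finset.mem_powerset] at hκ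
  have h0 : 0 ≤ legWeight (fun x => (1 + m x) / 2) K κ := by
    refine mul_nonneg (Finset.prod_nonneg fun x hx => ?_) (Finset.prod_nonneg fun x hx => ?_)
    · have := abs_le.1 (hm x (hκ hx)); linarith
    · have := abs_le.1 (hm x (Finset.mem_sdiff.1 hx).1); linarith
  have hc : (κ.card : ℝ) ≤ K.card := by exact_mod_cast Finset.card_le_card hκ
  have hc0 : (0 : ℝ) ≤ κ.card := Nat.cast_nonneg _
  rw [abs_mul, abs_mul, abs_of_nonneg h0, abs_of_nonneg (Nat.cast_nonneg _), ← mul_assoc,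
    mul_comm ((K.card : ℝ) + 2)]
  refine mul_le_mul_of_nonneg_left ?_ (mul_nonneg h0 (Nat.cast_nonneg _))
  rw [abs_le]
  constructor <;> linarith

end Legs

/-! ### Limit states -/

section LimitState

variable {W : Type*} {G : SimpleGraph W} [G.LocallyFinite] {o : W} {par : W → W} {dep : W → ℕ}
  {R : Finset W} {q : W → ℝ}

/-- The mixture of valence bond states of `R` as a density matrix. -/
def bondState (G : SimpleGraph W) [G.LocallyFinite] (o : W) (par : W → W) (q : W → ℝ)
    (R : Finset W) : Obs G R :=
  (bondMixture G o par q R).trace⁻¹ • bondMixture G o par q R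

theorem isGroundState_bondState (h : IsRootedTree G o par dep) (h0 : ∀ x, 0 ≤ q x)
    (h1 : ∀ x, q x ≤ 1) (ht : (bondMixture G o par q R).trace ≠ 0) :
    IsGroundState G R (bondState G o par q R) where
  posSemidef := by
    have hp := posSemidef_bondMixture (G := G) (o := o) (par := par) (R := R) h0 h1
    exact hp.smul (inv_nonneg.2 hp.trace_nonneg)
  trace_eq_one := by
    rw [bondState, Matrix.trace_smul, smul_eq_mul, inv_mul_cancel₀ ht]
  hamiltonian_mul := by
    rw [bondState, mul_smul_comm, hamiltonian_mul_bondMixture h, smul_zero]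

theorem extendObs_one {S : Finset W} (hS : S ⊆ R) : extendObs hS (1 : Obs G S) = 1 := by
  ext σ τ
  simp only [extendObs, Matrix.one_apply]
  by_cases hστ : σ = τ
  · subst hστ; simp
  · rw [if_neg hστ]
    split_ifs with h1 h2
    · refine absurd (funext fun z => ?_) hστ
      by_cases hz : (z : W) ∈ S
      · exact congrFun h2 ⟨z, hz⟩
      · exact h1 z hz
    · rfl
    · rfl

theorem extendObs_refl (hR : R ⊆ R) (A : Obs G R) : extendObs hR A = A := by
  ext σ τ
  simp [extendObs]

theorem bondMixture_insert (h : IsRootedTree G o par dep) (hR : IsParentClosed o par R)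
    (hq : IsConsistent G o par q) {c : W} (hc : c ∈ legs G o par R)
    (hpos : upWeight q (children G o par c) + downWeight q (children G o par c) ≠ 0)
    (ht : (bondMixture G o par q R).trace ≠ 0) :
    (bondMixture G o par q (insert c R)).trace ≠ 0 ∧
      ∀ S ⊆ R, ∀ A : Obs G S, expectation G (bondState G o par q (insert c R)) A =
        expectation G (bondState G o par q R) A := by
  have hcR := (h.mem_legs.1 hc).1
  have key := fun (S : Finset W) (hS : S ⊆ R) (A : Obs G S) =>
    trace_mul_extendObs_insert hcR hS (hS.trans (Finset.subset_insert c R)) A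
      (bondMixture G o par q (insert c R)) (bondMixture G o par q R) _
      (sum_bondMixture_glueConfig h hR hq hc)
  generalize hκ : ((upWeight q (children G o par c) + downWeight q (children G o par c) : ℝ) : ℂ)
    = κ at key
  have hκ0 : κ ≠ 0 := by
    rw [← hκ]
    exact_mod_cast hpos
  -- The identity observable shows that the trace is multiplied by the same factor $\kappa$, which
  -- therefore cancels in normalised expectations.
  have htr := key R subset_rfl 1
  rw [extendObs_one, extendObs_one, mul_one, mul_one] at htr
  refine ⟨by rw [htr]; exact mul_ne_zero hκ0 ht, fun S hS A => ?_⟩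
  rw [expectation, expectation, dif_pos hS, dif_pos (hS.trans (Finset.subset_insert c R)),
    bondState, bondState, smul_mul_assoc, smul_mul_assoc, Matrix.trace_smul, Matrix.trace_smul,
    key S hS A, htr, smul_eq_mul, smul_eq_mul]
  field_simp

/-- Legs of $R$ have their parents in $R$, so those not yet added remain legs while others are being
added. -/
theorem bondMixture_union (h : IsRootedTree G o par dep) (hR : IsParentClosed o par R)
    (hq : IsConsistent G o par q)
    (hpos : ∀ c, upWeight q (children G o par c) + downWeight q (children G o par c) ≠ 0)
    (ht : (bondMixture G o par q R).trace ≠ 0) (T : Finset W) (hT : T ⊆ legs G o par R) :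
    (bondMixture G o par q (R ∪ T)).trace ≠ 0 ∧
      ∀ S ⊆ R, ∀ A : Obs G S, expectation G (bondState G o par q (R ∪ T)) A =
        expectation G (bondState G o par q R) A := by
  induction T using Finset.induction_on with
  | empty =>
    rw [Finset.union_empty]
    exact ⟨ht, fun _ _ _ => rfl⟩
  | insert c T hcT ih =>
    have hT' : T ⊆ legs G o par R := (Finset.subset_insert c T).trans hT
    obtain ⟨ih1, ih2⟩ := ih hT'
    have hc := h.mem_legs.1 (hT (Finset.mem_insert_self c T))
    have hc' : c ∈ legs G o par (R ∪ T) := by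
      rw [h.mem_legs]
      refine ⟨?_, hc.2.1, Finset.mem_union_left _ hc.2.2⟩
      rw [Finset.mem_union]
      rintro (h' | h')
      · exact hc.1 h'
      · exact hcT h'
    obtain ⟨h1, h2⟩ := bondMixture_insert h (h.isParentClosed_union hR hT') hq hc' (hpos c) ih1
    rw [Finset.union_insert]
    exact ⟨h1, fun S hS A => (h2 S (hS.trans Finset.subset_union_left) A).trans (ih2 S hS A)⟩

theorem bondMixture_ball (h : IsRootedTree G o par dep) (hq : IsConsistent G o par q)
    (hpos : ∀ c, upWeight q (children G o par c) + downWeight q (children G o par c) ≠ 0)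
    (ht : (bondMixture G o par q (ball G o 0)).trace ≠ 0) (n : ℕ) :
    (bondMixture G o par q (ball G o n)).trace ≠ 0 := by
  induction n with
  | zero => exact ht
  | succ n ih =>
    rw [h.ball_succ_eq]
    exact (bondMixture_union h (h.isParentClosed_ball n) hq hpos ih _ subset_rfl).1

theorem expectation_bondState_ball (h : IsRootedTree G o par dep) (hq : IsConsistent G o par q)
    (hpos : ∀ c, upWeight q (children G o par c) + downWeight q (children G o par c) ≠ 0)
    (ht : (bondMixture G o par q (ball G o 0)).trace ≠ 0) {n k : ℕ} (hnk : n ≤ k)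
    {S : Finset W} (hS : S ⊆ ball G o n) (A : Obs G S) :
    expectation G (bondState G o par q (ball G o k)) A =
      expectation G (bondState G o par q (ball G o n)) A := by
  induction k, hnk using Nat.le_induction with
  | base => rfl
  | succ k hk ih =>
    rw [← ih, h.ball_succ_eq]
    refine (bondMixture_union h (h.isParentClosed_ball k) hq hpos
      (bondMixture_ball h hq hpos ht k) _ subset_rfl).2 S (fun x hx => ?_) A
    have := (h.mem_ball n x).1 (hS hx)
    exact (h.mem_ball k x).2 (this.trans hk)

/-- Consistent boundary conditions define an infinite-volume ground state, whose restriction to the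
root is explicit. -/
theorem exists_infiniteVolumeGroundState (h : IsRootedTree G o par dep) (h0 : ∀ x, 0 ≤ q x)
    (h1 : ∀ x, q x ≤ 1) (hq : IsConsistent G o par q)
    (hpos : ∀ c, upWeight q (children G o par c) + downWeight q (children G o par c) ≠ 0)
    (ht : (bondMixture G o par q (ball G o 0)).trace ≠ 0) :
    ∃ ω : ∀ R : Finset W, Obs G R → ℂ, IsInfiniteVolumeGroundState G o ω ∧
      ∀ A : Obs G (ball G o 0), ω _ A =
        (bondMixture G o par q (ball G o 0)).trace⁻¹ *
          (bondMixture G o par q (ball G o 0) * A).trace := by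
  have hsub : ∀ R : Finset W, ∃ n, R ⊆ ball G o n := fun R =>
    ⟨R.sup dep, fun x hx => (h.mem_ball _ x).2 (Finset.le_sup (f := dep) hx)⟩
  choose N hN using hsub
  -- By consistency the expectations are constant once the ball contains the region, so the limit is
  -- an eventual value.
  refine ⟨fun R A => expectation G (bondState G o par q (ball G o (N R))) A,
    ⟨fun n => bondState G o par q (ball G o n), fun n =>
      isGroundState_bondState h h0 h1 (bondMixture_ball h hq hpos ht n), fun R A => ?_⟩,
    fun A => ?_⟩
  · refine tendsto_const_nhds.congr' ?_
    filter_upwards [eventually_ge_atTop (N R)] with n hn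
    exact (expectation_bondState_ball h hq hpos ht hn (hN R) A).symm
  · dsimp only
    rw [expectation_bondState_ball h hq hpos ht (Nat.zero_le _) subset_rfl, expectation,
      dif_pos subset_rfl, extendObs_refl, bondState, smul_mul_assoc, Matrix.trace_smul,
      smul_eq_mul]

/-! ### The state at the root -/

open MvPolynomial

/-- On the single site $o$ the bond polynomial is the monomial $X_o^{|\eta|}$, so only one
configuration contributes. -/
theorem sum_polyAmplitude_root (h : IsRootedTree G o par dep) {η : Finset W}
    (hη : η ⊆ children G o par o) (f : ℕ → ℝ) :
    ∑ σ : Config G ({o} : Finset W), polyAmplitude {o} (bondPoly o par {o} η) σ *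
        polyAmplitude {o} (bondPoly o par {o} η) σ * f (σ ⟨o, Finset.mem_singleton_self o⟩) =
      ((Nat.factorial η.card * Nat.factorial ((children G o par o).card - η.card) : ℕ) : ℝ) *
        f η.card := by
  have hdeg : G.degree o = (children G o par o).card := by
    rw [h.degree_eq, if_pos rfl, add_zero]
  have hle : η.card ≤ G.degree o := by rw [hdeg]; exact Finset.card_le_card hη
  have hpoly : bondPoly o par {o} η = X o ^ η.card := by
    rw [bondPoly, Finset.erase_singleton, Finset.prod_empty, one_mul, ← Finset.prod_const]
    refine Finset.prod_congr rfl fun e he => ?_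
    rw [(h.mem_children.1 (hη he)).2]
  have hw : ∀ σ : Config G ({o} : Finset W), configWeight σ =
      ((Nat.factorial (σ ⟨o, Finset.mem_singleton_self o⟩) *
        Nat.factorial (G.degree o - σ ⟨o, Finset.mem_singleton_self o⟩) : ℕ) : ℝ) := by
    intro σ
    rw [configWeight]
    refine Fintype.prod_eq_single (⟨o, Finset.mem_singleton_self o⟩ : ({o} : Finset W)) ?_
    rintro ⟨x, hx⟩ hne
    exact absurd (Subtype.ext (Finset.mem_singleton.1 hx)) hne
  have he : ∀ σ : Config G ({o} : Finset W), configExponent σ =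
      Finsupp.single o (σ ⟨o, Finset.mem_singleton_self o⟩ : ℕ) := by
    intro σ
    ext x
    by_cases hx : x = o
    · subst hx
      rw [Finsupp.single_eq_same]
      exact configExponent_coe σ ⟨x, Finset.mem_singleton_self x⟩
    · rw [Finsupp.single_eq_of_ne hx, configExponent_of_notMem _ (by simpa using hx)]
  have ha : ∀ σ : Config G ({o} : Finset W), polyAmplitude {o} (bondPoly o par {o} η) σ =
      if (σ ⟨o, Finset.mem_singleton_self o⟩ : ℕ) = η.card then
        Real.sqrt ((Nat.factorial η.card * Nat.factorial (G.degree o - η.card) : ℕ) : ℝ)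
      else 0 := by
    intro σ
    rw [polyAmplitude, hpoly, he, hw, coeff_X_pow]
    have : Finsupp.single o η.card =
        Finsupp.single o (σ ⟨o, Finset.mem_singleton_self o⟩ : ℕ) ↔
        (σ ⟨o, Finset.mem_singleton_self o⟩ : ℕ) = η.card := by
      rw [(Finsupp.single_injective o).eq_iff, eq_comm]
    simp only [this]
    split_ifs with h'
    · rw [one_mul, h']
    · rw [zero_mul]
  simp only [ha]
  have hlt : ∀ x : ({o} : Finset W), η.card < G.degree (x : W) + 1 := by
    rintro ⟨x, hx⟩
    have hx' : x = o := Finset.mem_singleton.1 hx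
    subst hx'
    exact Nat.lt_succ_of_le hle
  rw [Finset.sum_eq_single (fun x => ⟨η.card, hlt x⟩)]
  · rw [if_pos rfl, Real.mul_self_sqrt (Nat.cast_nonneg _), ← hdeg]
  · intro σ _ hσ
    rw [if_neg, zero_mul, zero_mul]
    intro h'
    apply hσ
    ext ⟨x, hx⟩
    obtain rfl := Finset.mem_singleton.1 hx
    exact h'
  · simp

theorem trace_bondMixture_root_mul (h : IsRootedTree G o par dep) (f : ℕ → ℝ) :
    (bondMixture G o par q (ball G o 0) * Matrix.diagonal fun σ : Config G (ball G o 0) =>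
        ((f (σ ⟨o, Finset.mem_singleton_self o⟩) : ℝ) : ℂ)).trace =
      ((∑ η ∈ (children G o par o).powerset, legWeight q (children G o par o) η *
        (((Nat.factorial η.card * Nat.factorial ((children G o par o).card - η.card) : ℕ) : ℝ) *
          f η.card) : ℝ) : ℂ) := by
  have hlegs : legs G o par {o} = children G o par o := by
    ext x
    rw [h.mem_legs, h.mem_children]
    simp
  simp only [Matrix.trace, Matrix.diag_apply, Matrix.mul_diagonal]
  change ∑ σ : Config G ({o} : Finset W), bondMixture G o par q {o} σ σ * _ = _
  simp only [bondMixture]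
  simp only [← Complex.ofReal_mul, ← Complex.ofReal_sum]
  congr 1
  rw [hlegs]
  simp only [Finset.sum_mul]
  rw [Finset.sum_comm]
  refine Finset.sum_congr rfl fun η hη => ?_
  rw [← sum_polyAmplitude_root h (Finset.mem_powerset.1 hη) f, Finset.mul_sum]
  exact Finset.sum_congr rfl fun σ _ => mul_assoc _ _ _

/-- A stationary, non-vanishing staggered magnetisation breaks the uniqueness of the ground state. -/
theorem not_hasUniqueGroundState (h : IsRootedTree G o par dep) {μ : W → ℝ}
    (hμ : ∀ x, |μ x| ≤ 1)
    (hfix : ∀ x, (((children G o par x).card : ℝ) + 2) * legMass μ (children G o par x) * μ x =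
      legMoment μ (children G o par x)) (hμo : μ o ≠ 0) :
    ¬ HasUniqueGroundState G o := by
  -- The test observable is $2S^z$ at the root. The sign $s$ chooses between the two staggered
  -- patterns.
  have key : ∀ s : ℝ, s = 1 ∨ s = -1 → ∃ ω : ∀ R : Finset W, Obs G R → ℂ,
      IsInfiniteVolumeGroundState G o ω ∧
      ω (ball G o 0) (Matrix.diagonal fun σ : Config G (ball G o 0) =>
        ((2 * ((σ ⟨o, Finset.mem_singleton_self o⟩ : ℕ) : ℝ) - (children G o par o).card : ℝ) : ℂ))
        = ((-s * ((((children G o par o).card : ℝ) + 2) * μ o) : ℝ) : ℂ) := by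
    intro s hs
    have hsgn : ∀ n : ℕ, s * (-1) ^ n = 1 ∨ s * (-1) ^ n = -1 := by
      intro n
      rcases hs with rfl | rfl <;> rcases neg_one_pow_eq_or ℝ n with h' | h' <;> simp [h']
    -- A singlet reverses the magnetisation along each edge; the alternating sign turns the equation
    -- for $m$ into the sign-free one for $\mu$.
    set m : W → ℝ := fun x => s * (-1) ^ dep x * μ x with hm
    have hm1 : ∀ x, |m x| ≤ 1 := by
      intro x
      rcases hsgn (dep x) with h' | h' <;> simp only [hm, h'] <;> simpa using hμ x
    have hchild : ∀ x, ∀ y ∈ children G o par x, m y = -(s * (-1) ^ dep x) * μ y := by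
      intro x y hy
      obtain ⟨hy1, hy2⟩ := h.mem_children.1 hy
      simp only [hm]
      rw [h.dep_par y hy1, hy2, pow_succ]
      ring
    have hmass : ∀ x, legMass m (children G o par x) = legMass μ (children G o par x) := by
      intro x
      rw [legMass_congr (hchild x)]
      rcases hsgn (dep x) with h' | h' <;> rw [h']
      · simpa using legMass_neg μ _
      · simp
    have hmoment : ∀ x, legMoment m (children G o par x) =
        -(s * (-1) ^ dep x) * legMoment μ (children G o par x) := by
      intro x
      rw [legMoment_congr (hchild x)]
      rcases hsgn (dep x) with h' | h' <;> rw [h']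
      · simpa using legMoment_neg μ _
      · simp
    have hmpos : ∀ x, 0 < legMass m (children G o par x) := fun x =>
      zero_lt_one.trans_le (one_le_legMass fun y _ => hm1 y)
    have hq : IsConsistent G o par fun x => (1 + m x) / 2 := by
      intro c _
      have e1 := upWeight_add_downWeight m (children G o par c)
      have e2 := downWeight_sub_upWeight m (children G o par c)
      rw [e1]
      have e3 : (((children G o par c).card : ℝ) + 2) * legMass m (children G o par c) * m c =
          -legMoment m (children G o par c) := by
        rw [hmass, hmoment, ← hfix c]
        simp only [hm]
        ring
      -- The required equation is $q_c=(1+m_c)/2$ with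
      -- $m_c=(\mathrm{up}-\mathrm{down})/(\mathrm{up}+\mathrm{down})$, cleared of denominators.
      linear_combination (1 / 2) * e1 - (1 / 2) * e2 - (1 / 2) * e3
    have hpos : ∀ c, upWeight (fun x => (1 + m x) / 2) (children G o par c) +
        downWeight (fun x => (1 + m x) / 2) (children G o par c) ≠ 0 := by
      intro c
      rw [upWeight_add_downWeight]
      exact (mul_pos (by positivity) (hmpos c)).ne'
    have htr : (bondMixture G o par (fun x => (1 + m x) / 2) (ball G o 0)).trace =
        ((legMass m (children G o par o) : ℝ) : ℂ) := by
      have := trace_bondMixture_root_mul (q := fun x => (1 + m x) / 2) h fun _ => 1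
      simp only [Complex.ofReal_one, Matrix.diagonal_one, mul_one] at this
      exact this
    obtain ⟨ω, hω, hωA⟩ := exists_infiniteVolumeGroundState (q := fun x => (1 + m x) / 2) h
      (fun x => by have := abs_le.1 (hm1 x); linarith)
      (fun x => by have := abs_le.1 (hm1 x); linarith) hq hpos
      (by rw [htr]; exact_mod_cast (hmpos o).ne')
    refine ⟨ω, hω, ?_⟩
    rw [hωA, htr, trace_bondMixture_root_mul h
      fun n => 2 * (n : ℝ) - (children G o par o).card]
    change _ * ((legMoment m (children G o par o) : ℝ) : ℂ) = _
    rw [hmoment, ← hfix o, ← hmass, h.dep_root, ← Complex.ofReal_inv, ← Complex.ofReal_mul]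
    congr 1
    have := (hmpos o).ne'
    field_simp
  intro huniq
  obtain ⟨ω₁, h₁, e₁⟩ := key 1 (Or.inl rfl)
  obtain ⟨ω₂, h₂, e₂⟩ := key (-1) (Or.inr rfl)
  rw [huniq ω₁ ω₂ h₁ h₂, e₂, Complex.ofReal_inj] at e₁
  have : (0 : ℝ) < ((children G o par o).card : ℝ) + 2 := by positivity
  have h' := mul_ne_zero this.ne' hμo
  apply h'
  linarith

end LimitState

/-! ### The response of a vertex to the magnetisation of its legs -/

section Response

variable {W : Type*}

theorem sum_powerset_map {U M : Type*} [AddCommMonoid M] (f : U ↪ W) (K : Finset U)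
    (g : Finset W → M) :
    ∑ κ ∈ (K.map f).powerset, g κ = ∑ κ ∈ K.powerset, g (κ.map f) := by
  symm
  refine Finset.sum_bij (fun κ _ => κ.map f) ?_ ?_ ?_ ?_
  · intro κ hκ
    rw [Finset.mem_powerset] at hκ ⊢
    exact Finset.map_subset_map.2 hκ
  · intro κ _ κ' _ h
    exact Finset.map_injective f h
  · intro κ hκ
    rw [Finset.mem_powerset, Finset.subset_map_iff] at hκ
    obtain ⟨u, hu, rfl⟩ := hκ
    exact ⟨u, Finset.mem_powerset.2 hu, rfl⟩
  · intros; rfl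

theorem legWeight_map {U : Type*} (q : W → ℝ) (f : U ↪ W) (K κ : Finset U) :
    legWeight q (K.map f) (κ.map f) = legWeight (fun x => q (f x)) K κ := by
  have h : K.map f \ κ.map f = (K \ κ).map f := by
    ext x
    simp only [Finset.mem_sdiff, Finset.mem_map]
    constructor
    · rintro ⟨⟨a, ha, rfl⟩, h2⟩
      exact ⟨a, ⟨ha, fun h' => h2 ⟨a, h', rfl⟩⟩, rfl⟩
    · rintro ⟨a, ⟨ha, ha'⟩, rfl⟩
      refine ⟨⟨a, ha, rfl⟩, ?_⟩
      rintro ⟨a', h', he⟩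
      exact ha' (f.injective he ▸ h')
  rw [legWeight, legWeight, h, Finset.prod_map, Finset.prod_map]

theorem legMass_map {U : Type*} (m : W → ℝ) (f : U ↪ W) (K : Finset U) :
    legMass m (K.map f) = legMass (fun x => m (f x)) K := by
  simp only [legMass, sum_powerset_map, legWeight_map, Finset.card_map]

theorem legMoment_map {U : Type*} (m : W → ℝ) (f : U ↪ W) (K : Finset U) :
    legMoment m (K.map f) = legMoment (fun x => m (f x)) K := by
  simp only [legMoment, sum_powerset_map, legWeight_map, Finset.card_map]

/-- The magnetisation transmitted by a vertex with the legs in `K`, up to the sign. -/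
def legResponse (m : W → ℝ) (K : Finset W) : ℝ :=
  legMoment m K / (((K.card : ℝ) + 2) * legMass m K)

theorem legResponse_congr {m n : W → ℝ} {K : Finset W} (h : ∀ x ∈ K, m x = n x) :
    legResponse m K = legResponse n K := by
  rw [legResponse, legResponse, legMass_congr h, legMoment_congr h]

theorem mul_legResponse {m : W → ℝ} {K : Finset W} (hm : ∀ x ∈ K, |m x| ≤ 1) :
    ((K.card : ℝ) + 2) * legMass m K * legResponse m K = legMoment m K := by
  have h1 := one_le_legMass hm
  have h2 : (0 : ℝ) < ((K.card : ℝ) + 2) * legMass m K :=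
    mul_pos (by positivity) (by linarith)
  rw [legResponse, mul_div_cancel₀ _ h2.ne']

theorem abs_legResponse_le {m : W → ℝ} {K : Finset W} (hm : ∀ x ∈ K, |m x| ≤ 1) :
    |legResponse m K| ≤ 1 := by
  have h1 := one_le_legMass hm
  have h2 : (0 : ℝ) < ((K.card : ℝ) + 2) * legMass m K :=
    mul_pos (by positivity) (by linarith)
  rw [legResponse, abs_div, abs_of_pos h2, div_le_one h2]
  exact abs_legMoment_le hm

theorem legMoment_zero (K : Finset W) : legMoment (fun _ => 0) K = 0 := by
  have := legMoment_neg (fun _ : W => (0 : ℝ)) K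
  simp only [neg_zero] at this
  linarith

/-! ### Continuity and first-order expansion of the response -/

theorem continuousOn_legWeight {m : ℝ → W → ℝ} {s : Set ℝ} (K κ : Finset W)
    (hm : ∀ x, ContinuousOn (fun t => m t x) s) :
    ContinuousOn (fun t => legWeight (fun x => (1 + m t x) / 2) K κ) s := by
  simp only [legWeight]
  refine ContinuousOn.mul (continuousOn_finsetProd _ fun x _ => ?_)
    (continuousOn_finsetProd _ fun x _ => ?_)
  · exact (continuousOn_const.add (hm x)).div_const 2
  · exact continuousOn_const.sub ((continuousOn_const.add (hm x)).div_const 2)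

theorem continuousOn_legResponse {m : ℝ → W → ℝ} {s : Set ℝ} (K : Finset W)
    (hm : ∀ x, ContinuousOn (fun t => m t x) s) (hm1 : ∀ t ∈ s, ∀ x, |m t x| ≤ 1) :
    ContinuousOn (fun t => legResponse (m t) K) s := by
  simp only [legResponse]
  refine ContinuousOn.div ?_ (continuousOn_const.mul ?_) ?_
  · exact continuousOn_finsetSum _ fun κ _ =>
      (continuousOn_legWeight K κ hm).mul continuousOn_const
  · exact continuousOn_finsetSum _ fun κ _ =>
      (continuousOn_legWeight K κ hm).mul continuousOn_const
  · intro t ht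
    have := one_le_legMass (K := K) fun x _ => hm1 t ht x
    exact (mul_pos (by positivity) (by linarith)).ne'

theorem hasDerivAt_prod_one_add (K : Finset W) {m : ℝ → W → ℝ} {s : W → ℝ}
    (hm : ∀ x, HasDerivAt (fun t => m t x) (s x) 0) (h0 : ∀ x, m 0 x = 0) :
    HasDerivAt (fun t => ∏ x ∈ K, (1 + m t x)) (∑ x ∈ K, s x) 0 := by
  induction K using Finset.induction_on with
  | empty => simpa using hasDerivAt_const (0 : ℝ) (1 : ℝ)
  | insert a K ha ih =>
    simp only [Finset.prod_insert ha, Finset.sum_insert ha]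
    have := ((hm a).const_add 1).mul ih
    simp only [h0, add_zero, Finset.prod_const_one, mul_one, one_mul] at this
    exact this

theorem legWeight_half (m : W → ℝ) {K κ : Finset W} (hκ : κ ⊆ K) :
    legWeight (fun x => (1 + m x) / 2) K κ =
      (1 / 2) ^ K.card * ((∏ x ∈ κ, (1 + m x)) * ∏ x ∈ K \ κ, (1 + -m x)) := by
  have h1 : ∏ x ∈ κ, (1 + m x) / 2 = (1 / 2) ^ κ.card * ∏ x ∈ κ, (1 + m x) := by
    rw [← Finset.prod_const, ← Finset.prod_mul_distrib]
    exact Finset.prod_congr rfl fun x _ => by ring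
  have h2 : ∏ x ∈ K \ κ, (1 - (1 + m x) / 2) =
      (1 / 2) ^ (K \ κ).card * ∏ x ∈ K \ κ, (1 + -m x) := by
    rw [← Finset.prod_const, ← Finset.prod_mul_distrib]
    exact Finset.prod_congr rfl fun x _ => by ring
  have h3 : K.card = κ.card + (K \ κ).card := by
    rw [add_comm, Finset.card_sdiff_add_card_eq_card hκ]
  rw [legWeight, h1, h2, h3, pow_add]
  ring

theorem hasDerivAt_legWeight {K κ : Finset W} (hκ : κ ⊆ K) {m : ℝ → W → ℝ} {s : W → ℝ}
    (hm : ∀ x, HasDerivAt (fun t => m t x) (s x) 0) (h0 : ∀ x, m 0 x = 0) :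
    HasDerivAt (fun t => legWeight (fun x => (1 + m t x) / 2) K κ)
      ((1 / 2) ^ K.card * (∑ x ∈ κ, s x - ∑ x ∈ K \ κ, s x)) 0 := by
  simp only [legWeight_half _ hκ]
  have h1 := hasDerivAt_prod_one_add κ hm h0
  have h2 := hasDerivAt_prod_one_add (K \ κ) (m := fun t x => -m t x) (s := fun x => -s x)
    (fun x => (hm x).fun_neg) (fun x => by rw [h0, neg_zero])
  have h3 := (h1.mul h2).const_mul ((1 / 2 : ℝ) ^ K.card)
  simp only [h0, neg_zero, add_zero, Finset.prod_const_one, mul_one, one_mul,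
    Finset.sum_neg_distrib, ← sub_eq_add_neg] at h3
  exact h3

theorem sum_sub_sum_sdiff {K κ : Finset W} (hκ : κ ⊆ K) (s : W → ℝ) :
    ∑ x ∈ κ, s x - ∑ x ∈ K \ κ, s x = ∑ x ∈ K, s x * if x ∈ κ then 1 else -1 := by
  have h1 : ∑ x ∈ K \ κ, s x * (if x ∈ κ then 1 else -1) = -∑ x ∈ K \ κ, s x := by
    rw [← Finset.sum_neg_distrib]
    refine Finset.sum_congr rfl fun x hx => ?_
    rw [if_neg (Finset.mem_sdiff.1 hx).2]
    ring
  have h2 : ∑ x ∈ κ, s x * (if x ∈ κ then 1 else -1) = ∑ x ∈ κ, s x :=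
    Finset.sum_congr rfl fun x hx => by rw [if_pos hx, mul_one]
  rw [← Finset.sum_sdiff hκ, h1, h2]
  ring

theorem sum_range_quadratic (n N : ℕ) :
    ∑ j ∈ Finset.range N, (4 * (j : ℝ) ^ 2 - 4 * n * j + n ^ 2 + n + 2) =
      2 * N * (N - 1) * (2 * N - 1) / 3 - 2 * n * N * (N - 1) + N * ((n : ℝ) ^ 2 + n + 2) := by
  induction N with
  | zero => simp
  | succ N ih =>
    rw [Finset.sum_range_succ, ih]
    push_cast
    ring

/-- The covariance of one leg with the total magnetisation, for unmagnetised legs. -/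
theorem sum_sign_mul_moment {K : Finset W} {i : W} (hi : i ∈ K) :
    ∑ κ ∈ K.powerset, (if i ∈ κ then 1 else -1) *
        (((Nat.factorial κ.card * Nat.factorial (K.card - κ.card) : ℕ) : ℝ) *
          (2 * (κ.card : ℝ) - K.card)) =
      ((K.card : ℝ) + 2) * (K.card + 1) * (Nat.factorial K.card : ℕ) / 3 := by
  -- Pairing $\kappa\subseteq L$ with $\kappa\cup\{i\}$ leaves $j!\,(n-j)!$ times a quadratic in
  -- $j=|\kappa|$, where $n=|L|$. The binomial coefficient counting the $\kappa$ of size $j$ turns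
  -- the factorials into $n!$, so only the quadratic remains to be summed over $0\le j\le n$.
  obtain ⟨L, hiL, rfl⟩ : ∃ L : Finset W, i ∉ L ∧ insert i L = K :=
    ⟨K.erase i, by simp, Finset.insert_erase hi⟩
  rw [Finset.sum_powerset_insert hiL, ← Finset.sum_add_distrib, Finset.card_insert_of_notMem hiL]
  have h1 : ∀ κ ∈ L.powerset,
      ((if i ∈ κ then 1 else -1) *
        (((Nat.factorial κ.card * Nat.factorial (L.card + 1 - κ.card) : ℕ) : ℝ) *
          (2 * (κ.card : ℝ) - (L.card + 1 : ℕ))) +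
      (if i ∈ insert i κ then 1 else -1) *
        (((Nat.factorial (insert i κ).card *
          Nat.factorial (L.card + 1 - (insert i κ).card) : ℕ) : ℝ) *
          (2 * ((insert i κ).card : ℝ) - (L.card + 1 : ℕ)))) =
      (fun j : ℕ => ((Nat.factorial j * Nat.factorial (L.card - j) : ℕ) : ℝ) *
        (4 * (j : ℝ) ^ 2 - 4 * L.card * j + L.card ^ 2 + L.card + 2)) κ.card := by
    intro κ hκ
    rw [Finset.mem_powerset] at hκ
    have hiκ : i ∉ κ := fun h => hiL (hκ h)
    obtain ⟨l, hl⟩ := Nat.exists_eq_add_of_le (Finset.card_le_card hκ)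
    rw [if_neg hiκ, if_pos (Finset.mem_insert_self i κ), Finset.card_insert_of_notMem hiκ, hl]
    dsimp only
    rw [show κ.card + l + 1 - κ.card = l + 1 by omega,
      show κ.card + l + 1 - (κ.card + 1) = l by omega, show κ.card + l - κ.card = l by omega,
      Nat.factorial_succ, Nat.factorial_succ]
    push_cast
    ring
  rw [Finset.sum_congr rfl h1]
  refine (Finset.sum_powerset_apply_card (fun j : ℕ =>
    ((Nat.factorial j * Nat.factorial (L.card - j) : ℕ) : ℝ) *
      (4 * (j : ℝ) ^ 2 - 4 * L.card * j + L.card ^ 2 + L.card + 2))).trans ?_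
  have h2 : ∀ j ∈ Finset.range (L.card + 1), L.card.choose j •
      (((Nat.factorial j * Nat.factorial (L.card - j) : ℕ) : ℝ) *
        (4 * (j : ℝ) ^ 2 - 4 * L.card * j + L.card ^ 2 + L.card + 2)) =
      (Nat.factorial L.card : ℕ) *
        (4 * (j : ℝ) ^ 2 - 4 * L.card * j + L.card ^ 2 + L.card + 2) := by
    intro j hj
    rw [nsmul_eq_mul, ← mul_assoc, ← Nat.cast_mul, ← mul_assoc,
      Nat.choose_mul_factorial_mul_factorial (Nat.lt_succ_iff.1 (Finset.mem_range.1 hj))]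
  rw [Finset.sum_congr rfl h2, ← Finset.mul_sum, sum_range_quadratic, Nat.factorial_succ]
  push_cast
  ring

/-- For unmagnetised legs the factorials cancel the binomial coefficients: all $|K|+1$ possible
numbers of up legs have equal weight. -/
theorem legMass_zero (K : Finset W) :
    legMass (fun _ => 0) K = (1 / 2) ^ K.card * (((K.card : ℝ) + 1) * (Nat.factorial K.card : ℕ)) := by
  have h1 : ∀ κ ∈ K.powerset, legWeight (fun _ => (1 + 0 : ℝ) / 2) K κ *
      ((Nat.factorial κ.card * Nat.factorial (K.card - κ.card) : ℕ) : ℝ) =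
      (fun j : ℕ => (1 / 2 : ℝ) ^ K.card *
        ((Nat.factorial j * Nat.factorial (K.card - j) : ℕ) : ℝ)) κ.card := by
    intro κ hκ
    rw [legWeight_half (fun _ => 0) (Finset.mem_powerset.1 hκ)]
    simp
  have h2 : ∀ j ∈ Finset.range (K.card + 1), K.card.choose j •
      ((1 / 2 : ℝ) ^ K.card * ((Nat.factorial j * Nat.factorial (K.card - j) : ℕ) : ℝ)) =
      (1 / 2 : ℝ) ^ K.card * (Nat.factorial K.card : ℕ) := by
    intro j hj
    rw [nsmul_eq_mul, mul_left_comm, ← Nat.cast_mul, ← mul_assoc (K.card.choose j),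
      Nat.choose_mul_factorial_mul_factorial (Nat.lt_succ_iff.1 (Finset.mem_range.1 hj))]
  rw [legMass, Finset.sum_congr rfl h1]
  refine (Finset.sum_powerset_apply_card (fun j : ℕ => (1 / 2 : ℝ) ^ K.card *
    ((Nat.factorial j * Nat.factorial (K.card - j) : ℕ) : ℝ))).trans ?_
  rw [Finset.sum_congr rfl h2, Finset.sum_const, Finset.card_range, nsmul_eq_mul]
  push_cast
  ring

/-- To first order, a vertex transmits one third of the sum of the magnetisations of its legs. -/
theorem hasDerivAt_legResponse (K : Finset W) {m : ℝ → W → ℝ} {s : W → ℝ}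
    (hm : ∀ x, HasDerivAt (fun t => m t x) (s x) 0) (h0 : ∀ x, m 0 x = 0) :
    HasDerivAt (fun t => legResponse (m t) K) ((1 / 3) * ∑ x ∈ K, s x) 0 := by
  have hm0 : m 0 = fun _ => 0 := funext h0
  have hN : HasDerivAt (fun t => legMoment (m t) K) ((1 / 2) ^ K.card *
      (((K.card : ℝ) + 2) * (K.card + 1) * (Nat.factorial K.card : ℕ) / 3 * ∑ x ∈ K, s x)) 0 := by
    have h1 := HasDerivAt.fun_sum (u := K.powerset) fun κ hκ =>
      (hasDerivAt_legWeight (Finset.mem_powerset.1 hκ) hm h0).mul_const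
        (((Nat.factorial κ.card * Nat.factorial (K.card - κ.card) : ℕ) : ℝ) *
          (2 * (κ.card : ℝ) - K.card))
    refine h1.congr_deriv ?_
    rw [Finset.mul_sum, Finset.mul_sum]
    have h2 : ∀ κ ∈ K.powerset,
        (1 / 2 : ℝ) ^ K.card * (∑ x ∈ κ, s x - ∑ x ∈ K \ κ, s x) *
          (((Nat.factorial κ.card * Nat.factorial (K.card - κ.card) : ℕ) : ℝ) *
            (2 * (κ.card : ℝ) - K.card)) =
        ∑ x ∈ K, (1 / 2 : ℝ) ^ K.card * (s x * ((if x ∈ κ then 1 else -1) *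
          (((Nat.factorial κ.card * Nat.factorial (K.card - κ.card) : ℕ) : ℝ) *
            (2 * (κ.card : ℝ) - K.card)))) := by
      intro κ hκ
      rw [sum_sub_sum_sdiff (Finset.mem_powerset.1 hκ), Finset.mul_sum, Finset.sum_mul]
      exact Finset.sum_congr rfl fun x _ => by ring
    rw [Finset.sum_congr rfl h2, Finset.sum_comm]
    refine Finset.sum_congr rfl fun x hx => ?_
    rw [← Finset.mul_sum, ← Finset.mul_sum, sum_sign_mul_moment hx]
    ring
  have hD : HasDerivAt (fun t => ((K.card : ℝ) + 2) * legMass (m t) K)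
      (((K.card : ℝ) + 2) * ∑ κ ∈ K.powerset, (1 / 2) ^ K.card *
        (∑ x ∈ κ, s x - ∑ x ∈ K \ κ, s x) *
          ((Nat.factorial κ.card * Nat.factorial (K.card - κ.card) : ℕ) : ℝ)) 0 :=
    (HasDerivAt.fun_sum (u := K.powerset) fun κ hκ =>
      (hasDerivAt_legWeight (Finset.mem_powerset.1 hκ) hm h0).mul_const _).const_mul _
  have hpos : (0 : ℝ) < ((K.card : ℝ) + 2) * legMass (m 0) K := by
    rw [hm0, legMass_zero]
    have := Nat.factorial_pos K.card
    positivity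
  refine (hN.fun_div hD hpos.ne').congr_deriv ?_
  -- The numerator vanishes at $0$, so the derivative of the denominator drops out of the quotient
  -- rule.
  rw [hm0, legMoment_zero, zero_mul, sub_zero, legMass_zero]
  have h3 : ((Nat.factorial K.card : ℕ) : ℝ) ≠ 0 := by exact_mod_cast Nat.factorial_ne_zero _
  have h4 : ((K.card : ℝ) + 1) ≠ 0 := by positivity
  have h5 : ((K.card : ℝ) + 2) ≠ 0 := by positivity
  field_simp

end Response

end
end AKLT

namespace QuasiCayley
open Filter Topology AKLT
open scoped Classical

noncomputable section

variable {V ι : Type*}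

/-! ### The path sum of a cell -/

/-- Every edge is a bridge: a new vertex is pendant, hence isolated once its edge is removed, and
new vertices give no detour around an edge of the cell. -/
theorem augmentation_isAcyclic {Λ : SimpleGraph V} (hΛ : Λ.IsAcyclic) (b : ι → V) :
    (augmentation Λ b).IsAcyclic := by
  have hpend : ∀ k, ¬ ((augmentation Λ b).deleteEdges {s(Sum.inr k, Sum.inl (b k))}).Reachable
      (Sum.inr k) (Sum.inl (b k)) := by
    rintro k ⟨w⟩
    obtain ⟨y, hy, -, -⟩ := SimpleGraph.Walk.exists_eq_cons_of_ne (by simp) w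
    rw [SimpleGraph.deleteEdges_adj] at hy
    rcases y with y | l
    · have : y = b k := hy.1
      exact hy.2 (by simp [this])
    · exact hy.1
  rw [SimpleGraph.isAcyclic_iff_forall_adj_isBridge]
  rintro (x | k) (y | l) hxy
  · rw [SimpleGraph.isBridge_iff]
    intro hr
    have hb := SimpleGraph.isAcyclic_iff_forall_adj_isBridge.1 hΛ (show Λ.Adj x y from hxy)
    rw [SimpleGraph.isBridge_iff] at hb
    apply hb
    rw [SimpleGraph.reachable_iff_reflTransGen] at hr ⊢
    -- Retracting each new vertex onto its boundary point maps a walk avoiding the edge to a walk in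
    -- the cell avoiding it; pendant edges collapse to points.
    refine Relation.ReflTransGen.lift' (f := Sum.elim id b) ?_ _ _ hr
    rintro (u | k) (v | l) huv
    · rw [SimpleGraph.deleteEdges_adj] at huv
      refine Relation.ReflTransGen.single ?_
      simp only [Sum.elim_inl, id]
      rw [SimpleGraph.deleteEdges_adj]
      refine ⟨huv.1, fun h => huv.2 ?_⟩
      have h' := congrArg (Sym2.map (Sum.inl : V → V ⊕ ι)) (Set.mem_singleton_iff.1 h)
      simpa using h'
    · rw [SimpleGraph.deleteEdges_adj] at huv
      have : u = b l := huv.1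
      subst this
      exact Relation.ReflTransGen.refl
    · rw [SimpleGraph.deleteEdges_adj] at huv
      have : v = b k := huv.1
      subst this
      exact Relation.ReflTransGen.refl
    · rw [SimpleGraph.deleteEdges_adj] at huv
      exact huv.1.elim
  · obtain rfl : x = b l := hxy
    rw [Sym2.eq_swap, SimpleGraph.isBridge_iff]
    exact hpend l
  · obtain rfl : y = b k := hxy
    rw [SimpleGraph.isBridge_iff]
    exact hpend k
  · exact hxy.elim

/-- In the acyclic augmentation the path to $v_k$ is unique: a geodesic of the cell followed by the
new edge, which accounts for the $+1$. -/
theorem pathSum_eq [Fintype ι] {Λ : SimpleGraph V} (hΛ : Λ.IsTree) (r : V) (b : ι → V) :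
    pathSum Λ r b = ∑ k : ι, (1 / 3 : ℝ) ^ (Λ.dist r (b k) + 1) := by
  refine Finset.sum_congr rfl fun k _ => ?_
  obtain ⟨p, hp, hpl⟩ := hΛ.1.exists_path_of_dist r (b k)
  let f : Λ →g augmentation Λ b := ⟨Sum.inl, fun h => h⟩
  have hadj : (augmentation Λ b).Adj (f (b k)) (Sum.inr k) := rfl
  have hq : ((p.map f).concat hadj).IsPath := by
    refine SimpleGraph.Walk.IsPath.concat ?_ ?_ hadj
    · exact SimpleGraph.Walk.IsPath.map Sum.inl_injective hp
    · rw [SimpleGraph.Walk.support_map, List.mem_map]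
      rintro ⟨x, -, hx⟩
      exact Sum.inl_ne_inr hx
  have hsub := (augmentation_isAcyclic hΛ.2 b).subsingleton_path (Sum.inl r) (Sum.inr k)
  rw [finsum_eq_single _ (⟨_, hq⟩ : (augmentation Λ b).Path (Sum.inl r) (Sum.inr k))
    fun x hx => absurd (Subsingleton.elim _ _) hx]
  change (1 / 3 : ℝ) ^ ((p.map f).concat hadj).length = _
  rw [SimpleGraph.Walk.length_concat, SimpleGraph.Walk.length_map, hpl]

/-! ### Parents -/

theorem exists_isRootedTree {Λ : SimpleGraph V} (hΛ : Λ.IsTree) (r : V) :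
    ∃ par : V → V, IsRootedTree Λ r par (Λ.dist r) := by
  have hex : ∀ x, ∃ y, x ≠ r → Λ.Adj x y ∧ Λ.dist r x = Λ.dist r y + 1 := by
    intro x
    by_cases hx : x = r
    · exact ⟨x, fun h => absurd hx h⟩
    · obtain ⟨p, hp⟩ := hΛ.1.exists_walk_length_eq_dist x r
      obtain ⟨y, hy, p', rfl⟩ := SimpleGraph.Walk.exists_eq_cons_of_ne hx p
      refine ⟨y, fun _ => ⟨hy, ?_⟩⟩
      have h1 := SimpleGraph.dist_le p'
      rw [SimpleGraph.Walk.length_cons, SimpleGraph.dist_comm] at hp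
      rw [SimpleGraph.dist_comm] at h1
      rcases hΛ.dist_eq_dist_add_one_of_adj r hy with h | h <;> omega
  choose par hpar using hex
  have huniq : ∀ x y z, Λ.Adj x y → Λ.Adj x z → Λ.dist r x = Λ.dist r y + 1 →
      Λ.dist r x = Λ.dist r z + 1 → y = z := by
    intro x y z hy hz hyd hzd
    -- A neighbour closer to the root is the second vertex of a geodesic to the root; paths in a
    -- tree are unique, so there is only one such neighbour.
    have hpath : ∀ w (hw : Λ.Adj x w), Λ.dist r x = Λ.dist r w + 1 →
        ∃ p : Λ.Walk x r, p.IsPath ∧ p.snd = w := by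
      intro w hw hwd
      obtain ⟨p, hp⟩ := hΛ.1.exists_walk_length_eq_dist w r
      refine ⟨SimpleGraph.Walk.cons hw p, ?_, by simp⟩
      apply SimpleGraph.Walk.isPath_of_length_eq_dist
      rw [SimpleGraph.Walk.length_cons, hp, SimpleGraph.dist_comm, SimpleGraph.dist_comm (u := x),
        hwd]
    obtain ⟨p, hp, rfl⟩ := hpath y hy hyd
    obtain ⟨q, hq, rfl⟩ := hpath z hz hzd
    rw [(hΛ.existsUnique_path x r).unique hp hq]
  refine ⟨par, ⟨SimpleGraph.dist_self, fun x hx => (hpar x hx).2, fun x y => ⟨fun hxy => ?_, ?_⟩⟩⟩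
  · have hne : ∀ u v, Λ.dist r u = Λ.dist r v + 1 → u ≠ r := by
      rintro u v h rfl
      rw [SimpleGraph.dist_self] at h
      omega
    rcases hΛ.dist_eq_dist_add_one_of_adj r hxy with h | h
    · have hx := hne _ _ h
      exact Or.inl ⟨hx, huniq x _ _ (hpar x hx).1 hxy (hpar x hx).2 h⟩
    · have hy := hne _ _ h
      exact Or.inr ⟨hy, huniq y _ _ (hpar y hy).1 hxy.symm (hpar y hy).2 h⟩
  · rintro (⟨hx, rfl⟩ | ⟨hy, rfl⟩)
    · exact (hpar x hx).1
    · exact (hpar y hy).1.symm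

/-- The parent map of the quasi-Cayley tree. -/
def treePar (r : V) (b : ι → V) (par : V → V) : List ι × V → List ι × V
  | ([], x) => ([], par x)
  | (k :: w, x) => if x = r then (w, b k) else (k :: w, par x)

/-- The depth of the root of the copy of the cell with index `w`. -/
def copyDep (b : ι → V) (dep : V → ℕ) : List ι → ℕ
  | [] => 0
  | k :: w => copyDep b dep w + dep (b k) + 1

theorem isRootedTree_graph {Λ : SimpleGraph V} {r : V} {par : V → V} {dep : V → ℕ}
    (h : IsRootedTree Λ r par dep) (b : ι → V) :
    IsRootedTree (graph Λ r b) ([], r) (treePar r b par)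
      (fun p => copyDep b dep p.1 + dep p.2) := by
  have hpar : ∀ p : List ι × V, p.2 ≠ r → treePar r b par p = (p.1, par p.2) := by
    rintro ⟨w | ⟨k, w⟩, x⟩ hx
    · rfl
    · simp only [treePar, if_neg hx]
  have hpar' : ∀ k (w : List ι), treePar r b par (k :: w, r) = (w, b k) := by
    intro k w
    simp only [treePar, if_true]
  have hadj : ∀ p q : List ι × V, p ≠ ([], r) → treePar r b par p = q →
      (graph Λ r b).Adj p q := by
    rintro ⟨w, x⟩ q hp rfl
    by_cases hx : x = r
    · subst hx
      rcases w with _ | ⟨k, w⟩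
      · exact absurd rfl hp
      · rw [hpar']
        exact Or.inr (Or.inr ⟨k, rfl, rfl, rfl⟩)
    · rw [hpar _ hx]
      exact Or.inl ⟨rfl, (h.adj_iff _ _).2 (Or.inl ⟨hx, rfl⟩)⟩
  refine ⟨by simp [copyDep, h.dep_root], ?_, fun p q => ⟨?_, ?_⟩⟩
  · rintro ⟨w, x⟩ hp
    by_cases hx : x = r
    · subst hx
      rcases w with _ | ⟨k, w⟩
      · exact absurd rfl hp
      · rw [hpar']
        simp [copyDep, h.dep_root]
    · rw [hpar _ hx]
      have := h.dep_par x hx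
      simp only [this]
      omega
  · rintro (⟨h1, h2⟩ | ⟨k, h1, h2, h3⟩ | ⟨k, h1, h2, h3⟩)
    · rcases (h.adj_iff _ _).1 h2 with ⟨h3, h4⟩ | ⟨h3, h4⟩
      · exact Or.inl ⟨fun h' => h3 (congrArg Prod.snd h'),
          (hpar p h3).trans (Prod.ext h1 h4)⟩
      · exact Or.inr ⟨fun h' => h3 (congrArg Prod.snd h'),
          (hpar q h3).trans (Prod.ext h1.symm h4)⟩
    · right
      obtain ⟨w, x⟩ := p
      obtain ⟨w', x'⟩ := q
      simp only at h1 h2 h3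
      subst h1 h2 h3
      exact ⟨by simp, hpar' _ _⟩
    · left
      obtain ⟨w, x⟩ := p
      obtain ⟨w', x'⟩ := q
      simp only at h1 h2 h3
      subst h1 h2 h3
      exact ⟨by simp, hpar' _ _⟩
  · rintro (⟨h1, h2⟩ | ⟨h1, h2⟩)
    · exact hadj p q h1 h2
    · exact (hadj q p h1 h2).symm

/-! ### The magnetisation of the cell -/

/-- A recursion from the leaves to the root stabilises. -/
theorem iterate_stable {dep : V → ℕ} {D : ℕ} (hD : ∀ x, dep x < D) {T : (V → ℝ) → V → ℝ}
    (hT : ∀ f g x, (∀ y, dep y = dep x + 1 → f y = g y) → T f x = T g x) (f : V → ℝ) :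
    T (T^[D] f) = T^[D] f := by
  -- Values at depth at least $D-j$ are final after $j$ steps, because $T$ at $x$ reads only the
  -- next deeper level. No vertex has depth $D$ or more, so the case $j=0$ is vacuous.
  have key : ∀ j x, D ≤ dep x + j → T^[j + 1] f x = T^[j] f x := by
    intro j
    induction j with
    | zero =>
      intro x hx
      have := hD x
      omega
    | succ j ih =>
      intro x hx
      rw [Function.iterate_succ_apply' T (j + 1), Function.iterate_succ_apply' T j]
      refine hT _ _ _ fun y hy => ?_
      rw [← Function.iterate_succ_apply' T j]
      exact ih y (by omega)
  ext1 x
  rw [← Function.iterate_succ_apply' T D f]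
  exact key D x (by omega)

/-- The vertices of the augmented copy of the cell with index `w`, as vertices of the tree. -/
def copyEmbedding (r : V) (w : List ι) : V ⊕ ι ↪ List ι × V where
  toFun := Sum.elim (fun y => (w, y)) fun k => (k :: w, r)
  inj' := by
    rintro (y | k) (z | l) h
    · simpa using h
    · exact absurd (congrArg (fun p => p.1.length) h) (by simp)
    · exact absurd (congrArg (fun p => p.1.length) h) (by simp)
    · simpa using h

theorem copyEmbedding_inl (r : V) (w : List ι) (y : V) :
    copyEmbedding r w (Sum.inl y) = (w, y) := rfl

theorem copyEmbedding_inr (r : V) (w : List ι) (k : ι) :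
    copyEmbedding r w (Sum.inr k) = (k :: w, r) := rfl

section Cell

variable [Fintype V] [Fintype ι]

/-- The children of the vertex `x` of the cell in its augmentation. -/
def cellChildren (r : V) (b : ι → V) (par : V → V) (x : V) : Finset (V ⊕ ι) :=
  Finset.univ.filter (Sum.elim (fun y => y ≠ r ∧ par y = x) fun k => b k = x)

theorem inl_mem_cellChildren {r : V} {b : ι → V} {par : V → V} {x y : V} :
    Sum.inl y ∈ cellChildren r b par x ↔ y ≠ r ∧ par y = x := by
  simp [cellChildren]

theorem inr_mem_cellChildren {r : V} {b : ι → V} {par : V → V} {x : V} {k : ι} :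
    Sum.inr k ∈ cellChildren r b par x ↔ b k = x := by
  simp [cellChildren]

/-- The roots of the copies attached to copy $w$ play the role of the new vertices $v_k$. This
reduces the equation on the infinite tree to one on a single augmented cell. -/
theorem children_graph {Λ : SimpleGraph V} {r : V} {par : V → V} {dep : V → ℕ}
    (h : IsRootedTree Λ r par dep) (b : ι → V) (w : List ι) (x : V) :
    children (graph Λ r b) ([], r) (treePar r b par) (w, x) =
      (cellChildren r b par x).map (copyEmbedding r w) := by
  ext ⟨w', y⟩
  rw [(isRootedTree_graph h b).mem_children, Finset.mem_map]
  constructor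
  · rintro ⟨h1, h2⟩
    rcases w' with _ | ⟨k, w'⟩
    · have hy : y ≠ r := fun hy => h1 (by rw [hy])
      simp only [treePar, Prod.mk.injEq] at h2
      refine ⟨Sum.inl y, inl_mem_cellChildren.2 ⟨hy, h2.2⟩, ?_⟩
      simp [copyEmbedding_inl, ← h2.1]
    · by_cases hy : y = r
      · simp only [treePar, hy, if_true, Prod.mk.injEq] at h2
        refine ⟨Sum.inr k, inr_mem_cellChildren.2 h2.2, ?_⟩
        simp [copyEmbedding_inr, h2.1, hy]
      · simp only [treePar, hy, if_false, Prod.mk.injEq] at h2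
        refine ⟨Sum.inl y, inl_mem_cellChildren.2 ⟨hy, h2.2⟩, ?_⟩
        simp [copyEmbedding_inl, h2.1]
  · rintro ⟨z | k, hz, he⟩
    · rw [inl_mem_cellChildren] at hz
      simp only [copyEmbedding_inl, Prod.mk.injEq] at he
      obtain ⟨rfl, rfl⟩ := he
      refine ⟨fun h' => hz.1 (congrArg Prod.snd h'), ?_⟩
      rcases w with _ | ⟨k, w⟩
      · simp [treePar, hz.2]
      · simp [treePar, hz.1, hz.2]
    · rw [inr_mem_cellChildren] at hz
      simp only [copyEmbedding_inr, Prod.mk.injEq] at he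
      obtain ⟨rfl, rfl⟩ := he
      exact ⟨by simp, by simp [treePar, hz]⟩

/-- One step of the recursion for the magnetisation in the cell, with magnetisation `t` at the new
vertices of the augmentation. -/
def cellStep (r : V) (b : ι → V) (par : V → V) (t : ℝ) (f : V → ℝ) (x : V) : ℝ :=
  legResponse (Sum.elim f fun _ => t) (cellChildren r b par x)

/-- One step of the linearised recursion. -/
def cellLinearStep (r : V) (b : ι → V) (par : V → V) (f : V → ℝ) (x : V) : ℝ :=
  (1 / 3) * ∑ c ∈ cellChildren r b par x, Sum.elim f (fun _ => 1) c

theorem cellStep_congr {Λ : SimpleGraph V} {r : V} {par : V → V} {dep : V → ℕ}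
    (h : IsRootedTree Λ r par dep) (b : ι → V) (t : ℝ) (f g : V → ℝ) (x : V)
    (hfg : ∀ y, dep y = dep x + 1 → f y = g y) :
    cellStep r b par t f x = cellStep r b par t g x := by
  refine legResponse_congr ?_
  rintro (y | k) hy
  · rw [inl_mem_cellChildren] at hy
    exact hfg y (by rw [h.dep_par y hy.1, hy.2])
  · rfl

theorem cellLinearStep_congr {Λ : SimpleGraph V} {r : V} {par : V → V} {dep : V → ℕ}
    (h : IsRootedTree Λ r par dep) (b : ι → V) (f g : V → ℝ) (x : V)
    (hfg : ∀ y, dep y = dep x + 1 → f y = g y) :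
    cellLinearStep r b par f x = cellLinearStep r b par g x := by
  rw [cellLinearStep, cellLinearStep]
  congr 1
  refine Finset.sum_congr rfl ?_
  rintro (y | k) hy
  · rw [inl_mem_cellChildren] at hy
    exact hfg y (by rw [h.dep_par y hy.1, hy.2])
  · rfl

theorem abs_iterate_cellStep_le (r : V) (b : ι → V) (par : V → V) {t : ℝ} (ht : |t| ≤ 1) (n : ℕ)
    (x : V) : |(cellStep r b par t)^[n] 0 x| ≤ 1 := by
  induction n generalizing x with
  | zero => simp
  | succ n ih =>
    rw [Function.iterate_succ_apply']
    refine abs_legResponse_le ?_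
    rintro (y | k) -
    · exact ih y
    · exact ht

theorem continuousOn_iterate_cellStep (r : V) (b : ι → V) (par : V → V) (n : ℕ) (x : V) :
    ContinuousOn (fun t => (cellStep r b par t)^[n] 0 x) (Set.Icc (-1) 1) := by
  induction n generalizing x with
  | zero => exact continuousOn_const
  | succ n ih =>
    simp only [Function.iterate_succ_apply']
    refine continuousOn_legResponse (m := fun t => Sum.elim ((cellStep r b par t)^[n] 0)
      fun _ => t) _ ?_ ?_
    · rintro (y | k)
      · exact ih y
      · exact continuousOn_id
    · rintro t ht (y | k)
      · exact abs_iterate_cellStep_le r b par (abs_le.2 ht) n y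
      · exact abs_le.2 ht

theorem iterate_cellStep_zero (r : V) (b : ι → V) (par : V → V) (n : ℕ) (x : V) :
    (cellStep r b par 0)^[n] 0 x = 0 := by
  induction n generalizing x with
  | zero => rfl
  | succ n ih =>
    rw [Function.iterate_succ_apply', cellStep,
      legResponse_congr (n := fun _ => (0 : ℝ)), legResponse, legMoment_zero, zero_div]
    rintro (y | k) -
    · exact ih y
    · rfl

/-- The chain rule along the recursion: all values vanish at $t=0$, where the response is
linearised, and the new vertices have slope $1$. -/
theorem hasDerivAt_iterate_cellStep (r : V) (b : ι → V) (par : V → V) (n : ℕ) (x : V) :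
    HasDerivAt (fun t => (cellStep r b par t)^[n] 0 x) ((cellLinearStep r b par)^[n] 0 x) 0 := by
  induction n generalizing x with
  | zero => exact hasDerivAt_const _ _
  | succ n ih =>
    simp only [Function.iterate_succ_apply']
    refine hasDerivAt_legResponse (m := fun t => Sum.elim ((cellStep r b par t)^[n] 0)
      fun _ => t) (s := Sum.elim ((cellLinearStep r b par)^[n] 0) fun _ => 1) _ ?_ ?_
    · rintro (y | k)
      · exact ih y
      · exact hasDerivAt_id _
    · rintro (y | k)
      · exact iterate_cellStep_zero r b par n y
      · rfl

/-- A fixed point of the linearised recursion computes the path sum. -/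
theorem eq_sum_of_cellLinearStep_eq {Λ : SimpleGraph V} {r : V} {par : V → V} {dep : V → ℕ}
    (h : IsRootedTree Λ r par dep) (b : ι → V) {f : V → ℝ} (hf : cellLinearStep r b par f = f) :
    f r = ∑ k : ι, (1 / 3 : ℝ) ^ (dep (b k) + 1) := by
  have h1 : ∀ x, f x = (1 / 3) * ((∑ y, if y ≠ r ∧ par y = x then f y else 0) +
      ∑ k, if b k = x then 1 else 0) := by
    intro x
    conv_lhs => rw [← hf]
    rw [cellLinearStep, cellChildren, Finset.sum_filter, Fintype.sum_sum_type]
    refine congrArg _ (congrArg₂ _ (Finset.sum_congr rfl fun y _ => ?_)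
      (Finset.sum_congr rfl fun k _ => ?_))
    · exact if_congr Iff.rfl rfl rfl
    · exact if_congr Iff.rfl rfl rfl
  -- Weighted by $3^{-\mathrm{dep}\,x}$ and summed over the cell, the equations telescope: the term
  -- of each vertex other than the root reappears in the equation of its parent, leaving $f(r)$ and
  -- the boundary terms.
  have h2 : ∑ x, (1 / 3 : ℝ) ^ dep x * f x =
      ∑ y ∈ Finset.univ.erase r, (1 / 3 : ℝ) ^ dep y * f y +
        ∑ k : ι, (1 / 3 : ℝ) ^ (dep (b k) + 1) := by
    have h3 : ∀ x, (1 / 3 : ℝ) ^ dep x * f x =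
        (∑ y, if y ≠ r ∧ par y = x then (1 / 3 : ℝ) ^ (dep x + 1) * f y else 0) +
          ∑ k, if b k = x then (1 / 3 : ℝ) ^ (dep x + 1) else 0 := by
      intro x
      rw [h1 x, ← mul_assoc, ← pow_succ, mul_add, Finset.mul_sum, Finset.mul_sum]
      simp only [mul_ite, mul_zero, mul_one]
    rw [Finset.sum_congr rfl fun x _ => h3 x, Finset.sum_add_distrib]
    congr 1
    · rw [Finset.sum_comm, ← Finset.add_sum_erase _ _ (Finset.mem_univ r)]
      simp only [ne_eq, not_true_eq_false, false_and, if_false, Finset.sum_const_zero, zero_add]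
      refine Finset.sum_congr rfl fun y hy => ?_
      have hy' := Finset.ne_of_mem_erase hy
      simp only [hy', not_false_eq_true, true_and]
      rw [Finset.sum_ite_eq, if_pos (Finset.mem_univ _), ← h.dep_par y hy']
    · rw [Finset.sum_comm]
      refine Finset.sum_congr rfl fun k _ => ?_
      rw [Finset.sum_ite_eq, if_pos (Finset.mem_univ _)]
  rw [← Finset.add_sum_erase _ _ (Finset.mem_univ r), h.dep_root, pow_zero, one_mul] at h2
  linarith

end Cell

/-- A self-map of `[-1, 1]` which vanishes at `0` with slope larger than `1` has a positive fixed
point. -/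
theorem exists_pos_fixedPoint {F : ℝ → ℝ} {c : ℝ} (hF : ContinuousOn F (Set.Icc (-1) 1))
    (hF1 : F 1 ≤ 1) (hF0 : F 0 = 0) (hd : HasDerivAt F c 0) (hc : 1 < c) :
    ∃ t, 0 < t ∧ t ≤ 1 ∧ F t = t := by
  have h1 : Tendsto (slope F 0) (𝓝[>] 0) (𝓝 c) :=
    (hasDerivAt_iff_tendsto_slope.1 hd).mono_left
      (nhdsWithin_mono _ fun x hx => (ne_of_gt hx : x ≠ 0))
  have h2 : ∀ᶠ t in 𝓝[>] (0 : ℝ), t ∈ Set.Ioo (0 : ℝ) 1 := Ioo_mem_nhdsGT zero_lt_one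
  -- Slope above $1$ gives $F(\varepsilon)>\varepsilon$ for some small $\varepsilon>0$, while
  -- $F(1)\le1$; the intermediate value theorem applies to $F(t)-t$ on $[\varepsilon,1]$, away from
  -- the trivial fixed point.
  obtain ⟨ε, hε, hε0, hε1⟩ := ((h1.eventually (lt_mem_nhds hc)).and h2).exists
  rw [slope_def_field, hF0, sub_zero, sub_zero, lt_div_iff₀ hε0, one_mul] at hε
  have hcont : ContinuousOn (fun t => F t - t) (Set.Icc ε 1) :=
    (hF.mono (Set.Icc_subset_Icc_left (by linarith))).sub continuousOn_id
  obtain ⟨t, ht, ht0⟩ := intermediate_value_Icc' hε1.le hcont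
    (show (0 : ℝ) ∈ Set.Icc (F 1 - 1) (F ε - ε) from ⟨by linarith, by linarith⟩)
  exact ⟨t, hε0.trans_le ht.1, ht.2, by linarith [ht0]⟩

end

end QuasiCayley

/-! ### Conclusion: a positive fixed point of the cell recursion -/

theorem mainTheorem5 {V ι : Type*} [Fintype V] [Fintype ι]
    (Λ : SimpleGraph V) (hΛ : Λ.IsTree) (r : V) (b : ι → V)
    (hsum : 1 < QuasiCayley.pathSum Λ r b) :
    ¬ AKLT.HasUniqueGroundState (QuasiCayley.graph Λ r b) ([], r) := by
  obtain ⟨par, h⟩ := QuasiCayley.exists_isRootedTree hΛ r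
  obtain ⟨D, hD⟩ : ∃ D, ∀ x, Λ.dist r x < D :=
    ⟨Finset.univ.sup (Λ.dist r) + 1, fun x => Nat.lt_succ_of_le (Finset.le_sup (Finset.mem_univ x))⟩
  -- After $D$ steps the linear recursion is stationary, so its value at the root, which is the
  -- derivative of $F$ at $0$, equals the path sum.
  rw [QuasiCayley.pathSum_eq hΛ, ← QuasiCayley.eq_sum_of_cellLinearStep_eq h b
    (QuasiCayley.iterate_stable hD (QuasiCayley.cellLinearStep_congr h b) 0)] at hsum
  obtain ⟨t, ht0, ht1, ht⟩ := QuasiCayley.exists_pos_fixedPoint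
    (QuasiCayley.continuousOn_iterate_cellStep r b par D r)
    (abs_le.1 (QuasiCayley.abs_iterate_cellStep_le r b par (by simp) D r)).2
    (QuasiCayley.iterate_cellStep_zero r b par D r)
    (QuasiCayley.hasDerivAt_iterate_cellStep r b par D r) hsum
  have ht' : |t| ≤ 1 := abs_le.2 ⟨by linarith, ht1⟩
  have hstab := QuasiCayley.iterate_stable hD (QuasiCayley.cellStep_congr h b t) 0
  have hle := QuasiCayley.abs_iterate_cellStep_le r b par ht' D
  generalize (QuasiCayley.cellStep r b par t)^[D] 0 = f at ht hstab hle
  refine AKLT.not_hasUniqueGroundState (QuasiCayley.isRootedTree_graph h b)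
    (μ := fun p => f p.2) (fun p => hle p.2) ?_ (by simpa [ht] using ht0.ne')
  rintro ⟨w, x⟩
  -- The fixed-point equation $f(r)=t$ enters here: the roots of the next copies carry exactly the
  -- value $t$ imposed on the new vertices of the cell.
  have hm : (fun c => f (QuasiCayley.copyEmbedding r w c).2) =
      (Sum.elim f fun _ : ι => t) := by
    ext1 c
    rcases c with y | k
    · rfl
    · exact ht
  rw [QuasiCayley.children_graph h, Finset.card_map, AKLT.legMass_map, AKLT.legMoment_map, hm]
  dsimp only
  rw [← congrFun hstab x]
  refine AKLT.mul_legResponse ?_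
  rintro (y | k) -
  · exact hle y
  · exact ht'
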